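/- Setting. A finite-horizon MDP $M$ with finite state space $\mathcal S$ ($|\mathcal S|=S$), finite action space $\mathcal A$ ($|\mathcal A|=A$) and horizon $\tau\ge 1$ consists of reward distributions $R^M_a(s)$ supported in $[0,1]$ (with mean $\overline R^M_a(s)$), transition probabilities $P^M_a(\cdot\mid s)$ and an initial state distribution $\rho^M$. A (deterministic) policy $\mu$ maps each state and each step $i=1,\dots,\tau$ to an action, and $$V^M_{\mu,i}(s)=\mathbb E_{M,\mu}\Big[\sum_{j=i}^{\tau}\overline R^M_{a_j}(s_j)\,\Big|\,s_i=s\Big],\qquad a_j=\mu(s_j,j),\quad s_{j+1}\sim P^M_{a_j}(\cdot\mid s_j).$$ Fix a measurable choice $M\mapsto\mu^M$ of an optimal policy for each MDP, i.e. $V^M_{\mu^M,i}(s)=\max_{\mu'}V^M_{\mu',i}(s)$ for all $s$ and $i$. An agent interacts with a random MDP $M^*$ in episodes $k=1,2,\dots$ of length $\tau$, each starting from a fresh state drawn from $\rho^{M^*}$. Let $H_{t_k}$ be the history of states, actions and rewards observed before episode $k$. Posterior sampling (PSRL, $\pi^{\rm PS}_\tau$) with prior $f$ samples, at the start of episode $k$,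 an MDP $M_k\sim f(\cdot\mid H_{t_k})$ from the posterior given the history, and follows $\mu_k=\mu^{M_k}$ during the episode. Its regret up to time $T$ is $$\mathrm{Regret}(T,\pi^{\rm PS}_\tau)=\sum_{k=1}^{\lceil T/\tau\rceil}\Delta_k,\qquad \Delta_k=\sum_{s\in\mathcal S}\rho^{M^*}(s)\big(V^{M^*}_{\mu^{M^*},1}(s)-V^{M^*}_{\mu_k,1}(s)\big).$$ Theorem. There is an absolute constant $C$ such that for all finite $\mathcal S$ and $\mathcal A$, all $\tau\ge 1$, all $T\ge 0$, every choice $M\mapsto\mu^M$ as above and every prior probability distribution $f$ on MDPs: if $f$ is the distribution of $M^*$, then the regret of PSRL with prior $f$ is integrable and $$\mathbb E\big[\mathrm{Regret}(T,\pi^{\rm PS}_\tau)\big]\le C\,\tau S\sqrt{A\,T\,\log(SAT)}$$ (for $T=0$ both sides are $0$). -/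

import Mathlib

open MeasureTheory ProbabilityTheory

noncomputable section

namespace PSRL

/-- A Markov decision process with finite state space `S` and finite action space `A` (the horizon
`τ` is kept as a separate parameter). `reward s a` is the distribution, on `[0,1]`, of the reward
for taking action `a` in state `s`; `trans s a s'` is the probability of moving from `s` to `s'`
under `a`; `init` is the initial state distribution. -/
structure MDP (S A : Type*) [Fintype S] where
  reward : S → A → ProbabilityMeasure unitInterval
  trans : S → A → stdSimplex ℝ S
  init : stdSimplex ℝ S

/-- A deterministic policy for horizon `τ`: an action for every step of the episode and every
state. Steps are numbered `0, …, τ - 1`. -/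
abbrev Policy (S A : Type*) (τ : ℕ) : Type _ := Fin τ → S → A

/-- What is observed in one episode: the state, action and reward of each of its `τ` steps. -/
abbrev Episode (S A : Type*) (τ : ℕ) : Type _ := Fin τ → S × A × unitInterval

/-- The history of observations made in the first `k` episodes. -/
abbrev History (S A : Type*) (τ k : ℕ) : Type _ := Fin k → Episode S A τ

/-- A record of the first `k` episodes: the policies that were used and what was observed. -/
abbrev Record (S A : Type*) (τ k : ℕ) : Type _ := Fin k → Policy S A τ × Episode S A τ

/-- The step before `j` (used only for `j ≠ 0`). -/
def prev {τ : ℕ} (j : Fin τ) : Fin τ := ⟨j.1 - 1, lt_of_le_of_lt (Nat.sub_le _ _) j.2⟩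

section MDP

variable {S A : Type*} [Fintype S] {τ : ℕ}

/-- The σ-algebra on MDPs generated by the transition probabilities, the initial probabilities and
the maps `M ↦ R^M_a(s)(B)` for Borel sets `B`. -/
instance : MeasurableSpace (MDP S A) :=
  MeasurableSpace.comap (fun M : MDP S A => (M.reward, M.trans, M.init)) inferInstance

namespace MDP

/-- The mean reward of action `a` in state `s`. -/
def meanReward (M : MDP S A) (s : S) (a : A) : ℝ :=
  ∫ r : unitInterval, (r : ℝ) ∂(M.reward s a : Measure unitInterval)

/-- The probability that, under `μ`, the MDP moves at step `j` to the state `x j`, given that it was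
in the state `x (j - 1)` at the step before. -/
def stepProb (M : MDP S A) (μ : Policy S A τ) (x : Fin τ → S) (j : Fin τ) : ℝ :=
  (M.trans (x (prev j)) (μ (prev j) (x (prev j))) : S → ℝ) (x j)

/-- The probability of the states `x i, x (i + 1), …` when the MDP is run from state `s` at step `i`
under the policy `μ`. The irrelevant coordinates before `i` are pinned to `s`, so that every
trajectory is represented by exactly one `x` of non-zero weight. -/
def trajProbFrom [DecidableEq S] (M : MDP S A) (μ : Policy S A τ) (i : Fin τ) (s : S)
    (x : Fin τ → S) : ℝ :=
  ∏ j : Fin τ, if j ≤ i then (if x j = s then 1 else 0) else M.stepProb μ x j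

/-- The value function `V^M_{μ,i}(s)`: the expected sum of the mean rewards from step `i` to the end
of the episode, when the state at step `i` is `s` and the policy `μ` is followed. -/
def value [DecidableEq S] (M : MDP S A) (μ : Policy S A τ) (i : Fin τ) (s : S) : ℝ :=
  ∑ x : Fin τ → S, M.trajProbFrom μ i s x *
    ∑ j ∈ Finset.Ici i, M.meanReward (x j) (μ j (x j))

/-- `μ` is optimal for `M`: it attains the maximal value from every step and every state. -/
def IsOptimal [DecidableEq S] (M : MDP S A) (μ : Policy S A τ) : Prop :=
  ∀ (i : Fin τ) (s : S),
    IsGreatest (Set.range fun μ' : Policy S A τ => M.value μ' i s) (M.value μ i s)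

/-- The probability that the states of an episode, started from the initial distribution and run
under `μ`, are `x`. -/
def trajProb (M : MDP S A) (μ : Policy S A τ) (x : Fin τ → S) : ℝ :=
  ∏ j : Fin τ, if (j : ℕ) = 0 then (M.init : S → ℝ) (x j) else M.stepProb μ x j

/-- The law of the observations of an episode in which `M` is run under the policy `μ`: the states
follow the Markov chain, the actions are prescribed by `μ`, and, given the states, the rewards are
independent with laws `R^M_{a_j}(s_j)`. -/
def episodeLaw [MeasurableSpace S] [MeasurableSpace A] (M : MDP S A) (μ : Policy S A τ) :
    Measure (Episode S A τ) :=
  ∑ x : Fin τ → S, ENNReal.ofReal (M.trajProb μ x) •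
    (Measure.pi fun j => (M.reward (x j) (μ j (x j)) : Measure unitInterval)).map
      fun r j => (x j, μ j (x j), r j)

end MDP

theorem measurable_toProd :
    Measurable fun M : MDP S A => (M.reward, M.trans, M.init) :=
  comap_measurable _

theorem measurable_reward (s : S) (a : A) :
    Measurable fun M : MDP S A => (M.reward s a : Measure unitInterval) := by
  have h : Measurable fun M : MDP S A => M.reward s a :=
    (measurable_pi_apply a).comp ((measurable_pi_apply s).comp measurable_toProd.fst)
  exact measurable_subtype_coe.comp h

theorem measurable_trans (s : S) (a : A) (s' : S) :
    Measurable fun M : MDP S A => (M.trans s a : S → ℝ) s' := by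
  have h : Measurable fun M : MDP S A => M.trans s a :=
    (measurable_pi_apply a).comp ((measurable_pi_apply s).comp measurable_toProd.snd.fst)
  exact (measurable_pi_apply s').comp (measurable_subtype_coe.comp h)

theorem measurable_init (s : S) : Measurable fun M : MDP S A => (M.init : S → ℝ) s :=
  (measurable_pi_apply s).comp (measurable_subtype_coe.comp measurable_toProd.snd.snd)

theorem measurable_trajProb (μ : Policy S A τ) (x : Fin τ → S) :
    Measurable fun M : MDP S A => M.trajProb μ x := by
  unfold MDP.trajProb MDP.stepProb
  refine Finset.measurable_prod _ fun j _ => ?_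
  split_ifs
  · exact measurable_init _
  · exact measurable_trans _ _ _

theorem measurable_pi_reward (μ : Policy S A τ) (x : Fin τ → S) :
    Measurable fun M : MDP S A =>
      Measure.pi fun j => (M.reward (x j) (μ j (x j)) : Measure unitInterval) := by
  refine Measurable.measure_of_isPiSystem_of_isProbabilityMeasure generateFrom_pi.symm
    isPiSystem_pi ?_
  rintro _ ⟨B, hB, rfl⟩
  simp only [Measure.pi_pi]
  refine Finset.measurable_prod _ fun j _ => ?_
  exact (Measure.measurable_coe (show MeasurableSet (B j) from hB j (Set.mem_univ j))).comp (measurable_reward _ _)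

theorem measurable_episodeLaw [MeasurableSpace S] [MeasurableSpace A] (μ : Policy S A τ) :
    Measurable fun M : MDP S A => M.episodeLaw μ := by
  refine Measure.measurable_of_measurable_coe _ fun B hB => ?_
  simp only [MDP.episodeLaw, Measure.finsetSum_apply, Measure.smul_apply, smul_eq_mul]
  refine Finset.measurable_sum _ fun x _ => ?_
  refine (measurable_trajProb μ x).ennreal_ofReal.mul ?_
  have hm : Measurable fun (r : Fin τ → unitInterval) (j : Fin τ) => (x j, μ j (x j), r j) := by
    fun_prop
  exact (Measure.measurable_coe hB).comp ((Measure.measurable_map _ hm).comp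
    (measurable_pi_reward μ x))

end MDP

theorem sum_prod_step_eq_one {S : Type*} [Fintype S] [Nonempty S] : ∀ {n : ℕ} (h : Fin n → S → S → ℝ),
    (∀ j y, ∑ y', h j y y' = 1) → (∀ j : Fin n, (j : ℕ) = 0 → ∀ y z, h j y = h j z) →
    ∑ x : Fin n → S, ∏ j, h j (x (prev j)) (x j) = 1
  | 0, h, _, _ => by simp
  | n + 1, h, h1, h0 => by
    rw [← (Fin.snocEquiv fun _ : Fin (n + 1) => S).sum_comp, Fintype.sum_prod_type_right]
    have key : ∀ x : Fin n → S,
        ∑ y : S, ∏ j : Fin (n + 1),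
          h j ((Fin.snocEquiv fun _ : Fin (n + 1) => S) (y, x) (prev j))
            ((Fin.snocEquiv fun _ : Fin (n + 1) => S) (y, x) j) =
        ∏ j : Fin n, h j.castSucc (x (prev j)) (x j) := by
      intro x
      have hp : ∀ j : Fin n, prev j.castSucc = (prev j).castSucc := fun j => rfl
      simp only [Fin.snocEquiv_apply, Fin.prod_univ_castSucc, Fin.snoc_castSucc, hp,
        Fin.snoc_last]
      rw [← Finset.mul_sum]
      convert mul_one _
      rcases Nat.eq_zero_or_pos n with rfl | hn
      · obtain ⟨z⟩ := ‹Nonempty S›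
        rw [← h1 (Fin.last 0) z]
        exact Finset.sum_congr rfl fun y _ => by rw [h0 (Fin.last 0) rfl _ z]
      · have : prev (Fin.last n) = (⟨n - 1, by omega⟩ : Fin n).castSucc := rfl
        rw [this]
        simp only [Fin.snoc_castSucc]
        exact h1 _ _
    rw [Finset.sum_congr rfl fun x _ => key x]
    exact sum_prod_step_eq_one (fun j => h j.castSucc) (fun j => h1 _) fun j hj => h0 _ hj

theorem nonempty_of_MDP {S A : Type*} [Fintype S] (M : MDP S A) : Nonempty S := by
  by_contra hS
  rw [not_nonempty_iff] at hS
  have := M.init.2.2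
  simp at this

theorem trajProb_nonneg {S A : Type*} [Fintype S] {τ : ℕ} (M : MDP S A) (μ : Policy S A τ)
    (x : Fin τ → S) : 0 ≤ M.trajProb μ x := by
  refine Finset.prod_nonneg fun j _ => ?_
  split_ifs
  · exact M.init.2.1 _
  · exact (M.trans _ _).2.1 _

theorem sum_trajProb {S A : Type*} [Fintype S] {τ : ℕ} (M : MDP S A) (μ : Policy S A τ) :
    ∑ x : Fin τ → S, M.trajProb μ x = 1 := by
  have := nonempty_of_MDP M
  refine sum_prod_step_eq_one
    (fun j y y' => if (j : ℕ) = 0 then (M.init : S → ℝ) y' else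
      (M.trans y (μ (prev j) y) : S → ℝ) y') ?_ ?_
  · intro j y
    split_ifs
    · exact M.init.2.2
    · exact (M.trans _ _).2.2
  · intro j hj y z
    simp [hj]

section Record

variable {S A : Type*} {τ : ℕ}

/-- The observations contained in a record. -/
def Record.history {k : ℕ} (w : Record S A τ k) : History S A τ k := fun l => (w l).2

theorem measurable_history [MeasurableSpace S] [MeasurableSpace A] {k : ℕ} :
    Measurable (Record.history : Record S A τ k → History S A τ k) :=
  measurable_pi_lambda _ fun l => (measurable_pi_apply l).snd

end Record

section Interaction

variable {S A : Type*} [Fintype S] [Fintype A]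
  [MeasurableSpace S] [DiscreteMeasurableSpace S]
  [MeasurableSpace A] [DiscreteMeasurableSpace A] {τ : ℕ}

/-- The law of an episode, as a Markov kernel in the MDP and the policy. -/
def episodeKernel (S A : Type*) [Fintype S] [Fintype A]
    [MeasurableSpace S] [DiscreteMeasurableSpace S]
    [MeasurableSpace A] [DiscreteMeasurableSpace A] (τ : ℕ) :
    Kernel (MDP S A × Policy S A τ) (Episode S A τ) where
  toFun p := p.1.episodeLaw p.2
  measurable' := measurable_from_prod_countable_left fun μ => measurable_episodeLaw μ

/-- The record `w` of `k` episodes, continued by one more episode. -/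
def Record.extend {k : ℕ} (w : Record S A τ k) (μ : Policy S A τ) (e : Episode S A τ) :
    Record S A τ (k + 1) :=
  Fin.snoc (α := fun _ => Policy S A τ × Episode S A τ) w (μ, e)

instance isMarkovKernel_episodeKernel {S A : Type*} [Fintype S] [Fintype A]
    [MeasurableSpace S] [DiscreteMeasurableSpace S]
    [MeasurableSpace A] [DiscreteMeasurableSpace A] {τ : ℕ} :
    IsMarkovKernel (episodeKernel S A τ) := by
  refine ⟨fun p => ⟨?_⟩⟩
  have h : ∀ x : Fin τ → S,
      ((Measure.pi fun j => (p.1.reward (x j) (p.2 j (x j)) : Measure unitInterval)).map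
        fun r j => (x j, p.2 j (x j), r j)) Set.univ = 1 := by
    intro x
    have hm : Measurable fun (r : Fin τ → unitInterval) (j : Fin τ) =>
      (x j, p.2 j (x j), r j) := by fun_prop
    rw [Measure.map_apply hm MeasurableSet.univ]
    simp
  change (p.1.episodeLaw p.2) Set.univ = 1
  simp only [MDP.episodeLaw, Measure.finsetSum_apply, Measure.smul_apply, smul_eq_mul, h, mul_one]
  rw [← ENNReal.ofReal_sum_of_nonneg fun x _ => trajProb_nonneg _ _ _, sum_trajProb,
    ENNReal.ofReal_one]

theorem measurable_extend {S A : Type*} [MeasurableSpace S] [MeasurableSpace A] {τ k : ℕ} :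
    Measurable fun u : (Record S A τ k × Policy S A τ) × Episode S A τ =>
      Record.extend u.1.1 u.1.2 u.2 := by
  refine measurable_pi_lambda _ fun j => ?_
  refine Fin.lastCases ?_ (fun i => ?_) j
  · simp only [Record.extend, Fin.snoc_last]; fun_prop
  · simp only [Record.extend, Fin.snoc_castSucc]; fun_prop

/-- A reinforcement learning algorithm: for each episode `k`, a (measurable) map from the history of
the first `k` episodes to probability distributions over policies. -/
structure Algorithm (S A : Type*) [Fintype S] [Fintype A]
    [MeasurableSpace S] [MeasurableSpace A] (τ : ℕ) where
  policyDist : ∀ k : ℕ, Kernel (History S A τ k) (Policy S A τ)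
  isMarkov : ∀ k : ℕ, IsMarkovKernel (policyDist k)

/-- The joint law of the MDP `M*`, drawn from `ν`, and of the record of the first `k` episodes of
its interaction with the algorithm `π`: for each episode a policy is drawn from the distribution
that `π` prescribes given the history, and then the episode is run in `M*` under that policy. -/
def interactionLaw (ν : Measure (MDP S A)) (π : Algorithm S A τ) :
    (k : ℕ) → Measure (MDP S A × Record S A τ k)
  | 0 => ν.map fun M => (M, fun l => l.elim0)
  | k + 1 =>
    (((interactionLaw ν π k) ⊗ₘ
        (π.policyDist k).comap (fun p : MDP S A × Record S A τ k => Record.history p.2)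
          (measurable_history.comp measurable_snd)) ⊗ₘ
        (episodeKernel S A τ).comap
          (fun q : (MDP S A × Record S A τ k) × Policy S A τ => (q.1.1, q.2))
          (measurable_fst.fst.prodMk measurable_snd)).map
      fun u => (u.1.1.1, Record.extend u.1.1.2 u.1.2 u.2)

theorem isProbabilityMeasure_interactionLaw {S A : Type*} [Fintype S] [Fintype A]
    [MeasurableSpace S] [DiscreteMeasurableSpace S]
    [MeasurableSpace A] [DiscreteMeasurableSpace A] {τ : ℕ} (ν : Measure (MDP S A))
    [IsProbabilityMeasure ν] (π : Algorithm S A τ) :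
    ∀ k, IsProbabilityMeasure (interactionLaw ν π k)
  | 0 => by
    rw [interactionLaw]
    exact Measure.isProbabilityMeasure_map (by fun_prop)
  | k + 1 => by
    have := isProbabilityMeasure_interactionLaw ν π k
    have := π.isMarkov k
    rw [interactionLaw]
    refine Measure.isProbabilityMeasure_map (Measurable.aemeasurable ?_)
    refine measurable_fst.fst.fst.prodMk ?_
    exact measurable_extend.comp
      ((measurable_fst.fst.snd.prodMk measurable_fst.snd).prodMk measurable_snd)

/-- `Q` is the posterior distribution `f(· | H)` of the MDP given the history `H` of the first `k`
episodes: it is a regular conditional distribution of the MDP given `H` in the model where the MDP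
is drawn from the prior `f` and interacts with `π`. -/
def IsPosterior (f : Measure (MDP S A)) (π : Algorithm S A τ) (k : ℕ)
    (Q : Kernel (History S A τ k) (MDP S A)) : Prop :=
  IsMarkovKernel Q ∧
    (interactionLaw f π k).map (fun p => (Record.history p.2, p.1)) =
      (interactionLaw f π k).map (fun p => Record.history p.2) ⊗ₘ Q

/-- `π` is posterior sampling with prior `f`, where `opt M` is the optimal policy associated with
the MDP `M`: in each episode `k` it samples `M_k` from the posterior given the history, and uses
the policy `opt M_k`. -/
def IsPosteriorSampling (opt : MDP S A → Policy S A τ) (f : Measure (MDP S A))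
    (π : Algorithm S A τ) : Prop :=
  ∀ k : ℕ, ∃ Q : Kernel (History S A τ k) (MDP S A),
    IsPosterior f π k Q ∧ π.policyDist k = Q.map opt

/-- The regret of an episode in which the policy `μ` is used in the MDP `M`. -/
def episodeRegret [DecidableEq S] [NeZero τ] (opt : MDP S A → Policy S A τ) (M : MDP S A)
    (μ : Policy S A τ) : ℝ :=
  ∑ s : S, (M.init : S → ℝ) s * (M.value (opt M) 0 s - M.value μ 0 s)

/-- The number of episodes that begin up to time `T`. -/
def numEpisodes (τ T : ℕ) : ℕ := ⌈(T : ℝ) / (τ : ℝ)⌉₊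

/-- The regret up to time `T`, as a random variable: a function of the MDP and of the record of its
interaction with an algorithm. -/
def regret [DecidableEq S] [NeZero τ] (opt : MDP S A → Policy S A τ) (T : ℕ)
    (p : MDP S A × Record S A τ (numEpisodes τ T)) : ℝ :=
  ∑ k : Fin (numEpisodes τ T), episodeRegret opt p.1 (p.2 k).1

end Interaction

end PSRL

end

set_option linter.unusedSectionVars false

noncomputable section

namespace PSRL

section OneEpisode

theorem sum_prod_step_le_one {S : Type*} [Fintype S] [Nonempty S] :
    ∀ {n : ℕ} (h : Fin n → S → S → ℝ), (∀ j y z, 0 ≤ h j y z) →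
    (∀ j y, ∑ y', h j y y' ≤ 1) → (∀ j : Fin n, (j : ℕ) = 0 → ∀ y z, h j y = h j z) →
    ∑ x : Fin n → S, ∏ j, h j (x (prev j)) (x j) ≤ 1
  | 0, h, _, _, _ => by simp
  | n + 1, h, hn, h1, h0 => by
    rw [← (Fin.snocEquiv fun _ : Fin (n + 1) => S).sum_comp, Fintype.sum_prod_type_right]
    have hp : ∀ j : Fin n, prev j.castSucc = (prev j).castSucc := fun j => rfl
    have key : ∀ x : Fin n → S,
        ∑ y : S, ∏ j : Fin (n + 1),
          h j ((Fin.snocEquiv fun _ : Fin (n + 1) => S) (y, x) (prev j))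
            ((Fin.snocEquiv fun _ : Fin (n + 1) => S) (y, x) j) ≤
        ∏ j : Fin n, h j.castSucc (x (prev j)) (x j) := by
      intro x
      simp only [Fin.snocEquiv_apply, Fin.prod_univ_castSucc, Fin.snoc_castSucc, hp,
        Fin.snoc_last]
      rw [← Finset.mul_sum]
      refine mul_le_of_le_one_right (Finset.prod_nonneg fun j _ => hn _ _ _) ?_
      rcases Nat.eq_zero_or_pos n with rfl | hn'
      · obtain ⟨z⟩ := ‹Nonempty S›
        refine le_trans (le_of_eq ?_) (h1 (Fin.last 0) z)
        exact Finset.sum_congr rfl fun y _ => by rw [h0 (Fin.last 0) rfl _ z]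
      · have : prev (Fin.last n) = (⟨n - 1, by omega⟩ : Fin n).castSucc := rfl
        rw [this]
        simp only [Fin.snoc_castSucc]
        exact h1 _ _
    refine (Finset.sum_le_sum fun x _ => key x).trans ?_
    exact sum_prod_step_le_one (fun j => h j.castSucc) (fun j => hn _) (fun j => h1 _)
      fun j hj => h0 _ hj

/-- Two Markov chains differ in total variation by at most the expected sum, along the second
chain, of the total variations between their steps. -/
theorem sum_abs_prod_step_sub_le {S : Type*} [Fintype S] [Nonempty S] :
    ∀ {n : ℕ} (h h' : Fin n → S → S → ℝ), (∀ j y z, 0 ≤ h j y z) → (∀ j y z, 0 ≤ h' j y z) →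
    (∀ j y, ∑ y', h j y y' = 1) → (∀ j y, ∑ y', h' j y y' = 1) →
    (∀ j : Fin n, (j : ℕ) = 0 → ∀ y z, h j y = h j z) →
    (∀ j : Fin n, (j : ℕ) = 0 → ∀ y z, h' j y = h' j z) →
    ∑ x : Fin n → S, |∏ j, h' j (x (prev j)) (x j) - ∏ j, h j (x (prev j)) (x j)| ≤
      ∑ x : Fin n → S, (∏ j, h j (x (prev j)) (x j)) *
        ∑ j, ∑ y', |h' j (x (prev j)) y' - h j (x (prev j)) y'|
  | 0, h, h', _, _, _, _, _, _ => by simp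
  | n + 1, h, h', hn, hn', h1, h1', h0, h0' => by
    have ih := sum_abs_prod_step_sub_le (fun j => h j.castSucc) (fun j => h' j.castSucc)
      (fun j => hn _) (fun j => hn' _) (fun j => h1 _) (fun j => h1' _)
      (fun j hj => h0 _ hj) (fun j hj => h0' _ hj)
    have hp : ∀ j : Fin n, prev j.castSucc = (prev j).castSucc := fun j => rfl
    obtain ⟨z⟩ := ‹Nonempty S›
    -- the last kernels, as functions of the first `n` states
    have hlast : ∀ x : Fin n → S, ∃ w : S, ∀ y : S,
        h (Fin.last n) ((Fin.snoc (α := fun _ => S) x y : Fin (n + 1) → S) (prev (Fin.last n))) =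
          h (Fin.last n) w ∧
        h' (Fin.last n) ((Fin.snoc (α := fun _ => S) x y : Fin (n + 1) → S) (prev (Fin.last n))) =
          h' (Fin.last n) w := by
      intro x
      rcases Nat.eq_zero_or_pos n with rfl | hn'
      · exact ⟨z, fun y => ⟨h0 _ rfl _ _, h0' _ rfl _ _⟩⟩
      · have : prev (Fin.last n) = (⟨n - 1, by omega⟩ : Fin n).castSucc := rfl
        exact ⟨x ⟨n - 1, by omega⟩, fun y => by
          simp only [this, Fin.snoc_castSucc, and_self]⟩
    choose w hw using hlast
    have hw1 := fun x y => (hw x y).1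
    have hw2 := fun x y => (hw x y).2
    rw [← (Fin.snocEquiv fun _ : Fin (n + 1) => S).sum_comp, Fintype.sum_prod_type_right,
      ← (Fin.snocEquiv fun _ : Fin (n + 1) => S).sum_comp, Fintype.sum_prod_type_right]
    simp only [Fin.snocEquiv_apply, Fin.prod_univ_castSucc, Fin.sum_univ_castSucc,
      Fin.snoc_castSucc, hp, Fin.snoc_last, hw1, hw2]
    have e1 : ∀ x : Fin n → S,
        ∑ y : S, (∏ j : Fin n, h j.castSucc (x (prev j)) (x j)) * h (Fin.last n) (w x) y *
          (∑ j : Fin n, ∑ y', |h' j.castSucc (x (prev j)) y' - h j.castSucc (x (prev j)) y'| +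
            ∑ y', |h' (Fin.last n) (w x) y' - h (Fin.last n) (w x) y'|) =
        (∏ j : Fin n, h j.castSucc (x (prev j)) (x j)) *
          (∑ j : Fin n, ∑ y', |h' j.castSucc (x (prev j)) y' - h j.castSucc (x (prev j)) y'|) +
        (∏ j : Fin n, h j.castSucc (x (prev j)) (x j)) *
            ∑ y', |h' (Fin.last n) (w x) y' - h (Fin.last n) (w x) y'| := by
      intro x
      rw [← Finset.sum_mul, ← Finset.mul_sum, h1, mul_one, mul_add]
    have e2 : ∀ x : Fin n → S,
        ∑ y : S, |(∏ j : Fin n, h' j.castSucc (x (prev j)) (x j)) * h' (Fin.last n) (w x) y -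
          (∏ j : Fin n, h j.castSucc (x (prev j)) (x j)) * h (Fin.last n) (w x) y| ≤
        |∏ j : Fin n, h' j.castSucc (x (prev j)) (x j) -
          ∏ j : Fin n, h j.castSucc (x (prev j)) (x j)| +
        (∏ j : Fin n, h j.castSucc (x (prev j)) (x j)) *
            ∑ y', |h' (Fin.last n) (w x) y' - h (Fin.last n) (w x) y'| := by
      intro x
      have hp0 : 0 ≤ ∏ j : Fin n, h j.castSucc (x (prev j)) (x j) :=
        Finset.prod_nonneg fun j _ => hn _ _ _
      generalize (∏ j : Fin n, h j.castSucc (x (prev j)) (x j)) = p at *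
      generalize (∏ j : Fin n, h' j.castSucc (x (prev j)) (x j)) = p'
      calc _ ≤ ∑ y : S, (|p' - p| * h' (Fin.last n) (w x) y +
              p * |h' (Fin.last n) (w x) y - h (Fin.last n) (w x) y|) := by
            refine Finset.sum_le_sum fun y _ => ?_
            have : p' * h' (Fin.last n) (w x) y - p * h (Fin.last n) (w x) y =
              (p' - p) * h' (Fin.last n) (w x) y +
                p * (h' (Fin.last n) (w x) y - h (Fin.last n) (w x) y) := by ring
            rw [this]
            refine (abs_add_le _ _).trans (le_of_eq ?_)
            rw [abs_mul, abs_mul, abs_of_nonneg (hn' _ _ _), abs_of_nonneg hp0]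
        _ = _ := by
            rw [Finset.sum_add_distrib, ← Finset.mul_sum, ← Finset.mul_sum, h1', mul_one]
    calc _ ≤ _ := Finset.sum_le_sum fun x _ => e2 x
      _ ≤ _ := by
          rw [Finset.sum_congr rfl fun x _ => e1 x, Finset.sum_add_distrib,
            Finset.sum_add_distrib]
          exact add_le_add ih le_rfl

variable {S A : Type*} {τ : ℕ}

/-- What determines the law of the state at step `j` of an episode: the preceding state and action,
or nothing if `j` is the first step. -/
def Episode.context (e : Episode S A τ) (j : Fin τ) : Option (S × A) :=
  if (j : ℕ) = 0 then none else some ((e (prev j)).1, (e (prev j)).2.1)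

/-- The state and action at step `j` of an episode. -/
def Episode.stateAction (e : Episode S A τ) (j : Fin τ) : S × A := ((e j).1, (e j).2.1)

/-- The context of step `j` when a policy is followed along given states. -/
def Policy.context (μ : Policy S A τ) (j : Fin τ) (y : S) : Option (S × A) :=
  if (j : ℕ) = 0 then none else some (y, μ (prev j) y)

theorem Policy.context_zero (μ : Policy S A τ) (j : Fin τ) (hj : (j : ℕ) = 0) (y z : S) :
    μ.context j y = μ.context j z := by simp [Policy.context, hj]

theorem context_mk (μ : Policy S A τ) (x : Fin τ → S) (r : Fin τ → unitInterval) (j : Fin τ) :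
    Episode.context (fun j => (x j, μ j (x j), r j)) j = μ.context j (x (prev j)) := rfl

theorem stateAction_mk (μ : Policy S A τ) (x : Fin τ → S) (r : Fin τ → unitInterval) (j : Fin τ) :
    Episode.stateAction (fun j => (x j, μ j (x j), r j)) j = (x j, μ j (x j)) := rfl

@[fun_prop]
theorem measurable_stateAction [MeasurableSpace S] [MeasurableSpace A] (j : Fin τ) :
    Measurable fun e : Episode S A τ => e.stateAction j := by
  unfold Episode.stateAction
  fun_prop

variable [Fintype S]

/-- The law of the next state given a context. -/
def MDP.next (M : MDP S A) : Option (S × A) → stdSimplex ℝ S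
  | none => M.init
  | some c => M.trans c.1 c.2

theorem measurable_next (c : Option (S × A)) (s : S) :
    Measurable fun M : MDP S A => (M.next c : S → ℝ) s := by
  cases c with
  | none => exact measurable_init s
  | some c => exact measurable_trans _ _ s

theorem trajProb_eq (M : MDP S A) (μ : Policy S A τ) (x : Fin τ → S) :
    M.trajProb μ x = ∏ j, (M.next (μ.context j (x (prev j))) : S → ℝ) (x j) := by
  unfold MDP.trajProb MDP.stepProb
  refine Finset.prod_congr rfl fun j _ => ?_
  unfold Policy.context
  split_ifs <;> rfl

/-- The total mean reward collected along given states. -/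
def MDP.totalReward (M : MDP S A) (μ : Policy S A τ) (x : Fin τ → S) : ℝ :=
  ∑ j, M.meanReward (x j) (μ j (x j))

/-- The expected total reward of an episode. -/
def MDP.expectedReward (M : MDP S A) (μ : Policy S A τ) : ℝ :=
  ∑ x : Fin τ → S, M.trajProb μ x * M.totalReward μ x

theorem meanReward_nonneg (M : MDP S A) (s : S) (a : A) : 0 ≤ M.meanReward s a :=
  integral_nonneg fun r => r.2.1

theorem meanReward_le_one (M : MDP S A) (s : S) (a : A) : M.meanReward s a ≤ 1 := by
  have h : M.meanReward s a ≤ ∫ _ : unitInterval, (1 : ℝ) ∂(M.reward s a : Measure unitInterval) := by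
    refine integral_mono_of_nonneg (ae_of_all _ fun r => r.2.1) (integrable_const _)
      (ae_of_all _ fun r => r.2.2)
  simpa using h

theorem measurable_meanReward (s : S) (a : A) :
    Measurable fun M : MDP S A => M.meanReward s a := by
  have e : (fun M : MDP S A => M.meanReward s a) = fun M : MDP S A =>
      (∫⁻ r : unitInterval, ENNReal.ofReal r ∂(M.reward s a : Measure unitInterval)).toReal := by
    funext M
    exact integral_eq_lintegral_of_nonneg_ae (ae_of_all _ fun r => r.2.1)
      measurable_subtype_coe.aestronglyMeasurable
  rw [e]
  exact ((Measure.measurable_lintegral measurable_subtype_coe.ennreal_ofReal).comp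
    (measurable_reward s a)).ennreal_toReal

theorem totalReward_nonneg (M : MDP S A) (μ : Policy S A τ) (x : Fin τ → S) :
    0 ≤ M.totalReward μ x := Finset.sum_nonneg fun _ _ => meanReward_nonneg _ _ _

theorem totalReward_le (M : MDP S A) (μ : Policy S A τ) (x : Fin τ → S) :
    M.totalReward μ x ≤ τ := by
  refine (Finset.sum_le_sum fun j _ => meanReward_le_one M _ _).trans ?_
  simp

theorem expectedReward_nonneg (M : MDP S A) (μ : Policy S A τ) : 0 ≤ M.expectedReward μ :=
  Finset.sum_nonneg fun _ _ => mul_nonneg (trajProb_nonneg _ _ _) (totalReward_nonneg _ _ _)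

theorem expectedReward_le (M : MDP S A) (μ : Policy S A τ) : M.expectedReward μ ≤ τ := by
  calc M.expectedReward μ ≤ ∑ x, M.trajProb μ x * τ := Finset.sum_le_sum fun x _ =>
        mul_le_mul_of_nonneg_left (totalReward_le _ _ _) (trajProb_nonneg _ _ _)
    _ = τ := by rw [← Finset.sum_mul, sum_trajProb, one_mul]

theorem measurable_expectedReward (μ : Policy S A τ) :
    Measurable fun M : MDP S A => M.expectedReward μ := by
  unfold MDP.expectedReward MDP.totalReward
  exact Finset.measurable_sum _ fun x _ => (measurable_trajProb μ x).mul
    (Finset.measurable_sum _ fun j _ => measurable_meanReward _ _)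

theorem sum_init_mul_value [DecidableEq S] [NeZero τ] (M : MDP S A) (μ : Policy S A τ) :
    ∑ s, (M.init : S → ℝ) s * M.value μ 0 s = M.expectedReward μ := by
  unfold MDP.value MDP.expectedReward
  simp_rw [Finset.mul_sum (s := (Finset.univ : Finset (Fin τ → S)))]
  rw [Finset.sum_comm]
  refine Finset.sum_congr rfl fun x _ => ?_
  have hI : (Finset.Ici (0 : Fin τ)) = Finset.univ := by ext; simp
  rw [hI]
  change _ = _ * M.totalReward μ x
  simp_rw [← mul_assoc]
  rw [← Finset.sum_mul]
  change (∑ s, _) * M.totalReward μ x = _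
  congr 1
  unfold MDP.trajProbFrom MDP.trajProb
  rw [← Finset.mul_prod_erase _ _ (Finset.mem_univ (0 : Fin τ))]
  rw [Finset.sum_eq_single (x 0)]
  · rw [← Finset.mul_prod_erase _ _ (Finset.mem_univ (0 : Fin τ))]
    simp only [le_refl, if_true, one_mul, Fin.val_zero]
    congr 1
    refine Finset.prod_congr rfl fun j hj => ?_
    have : j ≠ 0 := (Finset.mem_erase.1 hj).1
    rw [if_neg (by simpa using this),
      if_neg (fun h => this (Fin.ext (by rw [h, Fin.val_zero])))]
  · intro s _ hs
    rw [← Finset.mul_prod_erase _ _ (Finset.mem_univ (0 : Fin τ))]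
    simp [Ne.symm hs]
  · simp

theorem sum_abs_trajProb_sub_le (M M' : MDP S A) (μ : Policy S A τ) :
    ∑ x : Fin τ → S, |M'.trajProb μ x - M.trajProb μ x| ≤
      ∑ x, M.trajProb μ x * ∑ j, ∑ y, |(M'.next (μ.context j (x (prev j))) : S → ℝ) y -
        (M.next (μ.context j (x (prev j))) : S → ℝ) y| := by
  have := nonempty_of_MDP M
  simp_rw [trajProb_eq]
  exact sum_abs_prod_step_sub_le
    (fun j y => (M.next (μ.context j y) : S → ℝ)) (fun j y => (M'.next (μ.context j y) : S → ℝ))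
    (fun _ _ _ => (M.next _).2.1 _) (fun _ _ _ => (M'.next _).2.1 _)
    (fun _ _ => (M.next _).2.2) (fun _ _ => (M'.next _).2.2)
    (fun j hj y z => by rw [μ.context_zero j hj y z])
    (fun j hj y z => by rw [μ.context_zero j hj y z])

/-- The distance between the transition laws of two MDPs in a given context. -/
def transDist (M M' : MDP S A) (c : Option (S × A)) : ℝ :=
  ∑ y, |(M'.next c : S → ℝ) y - (M.next c : S → ℝ) y|

/-- The distance between the mean rewards of two MDPs. -/
def rewardDist (M M' : MDP S A) (c : S × A) : ℝ :=
  |M'.meanReward c.1 c.2 - M.meanReward c.1 c.2|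

theorem expectedReward_sub_le (M M' : MDP S A) (μ : Policy S A τ) :
    M'.expectedReward μ - M.expectedReward μ ≤ ∑ x, M.trajProb μ x *
      (τ * ∑ j, transDist M M' (μ.context j (x (prev j))) +
        ∑ j, rewardDist M M' (x j, μ j (x j))) := by
  unfold MDP.expectedReward
  rw [← Finset.sum_sub_distrib]
  calc _ ≤ ∑ x, (τ * |M'.trajProb μ x - M.trajProb μ x| +
        M.trajProb μ x * ∑ j, rewardDist M M' (x j, μ j (x j))) := by
        refine Finset.sum_le_sum fun x _ => ?_
        have e : M'.trajProb μ x * M'.totalReward μ x - M.trajProb μ x * M.totalReward μ x =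
          (M'.trajProb μ x - M.trajProb μ x) * M'.totalReward μ x +
            M.trajProb μ x * (M'.totalReward μ x - M.totalReward μ x) := by ring
        rw [e]
        refine add_le_add ?_ (mul_le_mul_of_nonneg_left ?_ (trajProb_nonneg _ _ _))
        · rw [mul_comm (τ : ℝ)]
          refine (mul_le_mul_of_nonneg_right (le_abs_self _) (totalReward_nonneg _ _ _)).trans ?_
          exact mul_le_mul_of_nonneg_left (totalReward_le _ _ _) (abs_nonneg _)
        · unfold MDP.totalReward rewardDist
          rw [← Finset.sum_sub_distrib]
          exact Finset.sum_le_sum fun j _ => le_abs_self _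
    _ ≤ _ := by
        simp_rw [mul_add]
        rw [Finset.sum_add_distrib, Finset.sum_add_distrib, ← Finset.mul_sum]
        refine add_le_add ?_ le_rfl
        refine (mul_le_mul_of_nonneg_left (sum_abs_trajProb_sub_le M M' μ) (by positivity)).trans
          (le_of_eq ?_)
        rw [Finset.mul_sum]
        refine Finset.sum_congr rfl fun x _ => ?_
        unfold transDist
        ring

variable [MeasurableSpace S] [MeasurableSpace A]

theorem lintegral_episodeLaw (M : MDP S A) (μ : Policy S A τ) {F : Episode S A τ → ENNReal}
    (hF : Measurable F) :
    ∫⁻ e, F e ∂(M.episodeLaw μ) = ∑ x, ENNReal.ofReal (M.trajProb μ x) *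
      ∫⁻ r, F (fun j => (x j, μ j (x j), r j)) ∂(Measure.pi fun j =>
        (M.reward (x j) (μ j (x j)) : Measure unitInterval)) := by
  unfold MDP.episodeLaw
  rw [lintegral_finsetSum_measure]
  refine Finset.sum_congr rfl fun x _ => ?_
  rw [lintegral_smul_measure, lintegral_map hF (by fun_prop), smul_eq_mul]

variable [Fintype A] [DiscreteMeasurableSpace S] [DiscreteMeasurableSpace A]

theorem measurable_comp_context {β : Type*} [MeasurableSpace β] (φ : Option (S × A) → S → β)
    (j : Fin τ) : Measurable fun e : Episode S A τ => φ (e.context j) (e j).1 := by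
  unfold Episode.context
  split_ifs
  · exact (measurable_of_countable (φ none)).comp (measurable_pi_apply j).fst
  · exact (measurable_of_countable fun p : (S × A) × S => φ (some p.1) p.2).comp
      (f := fun e : Episode S A τ => (((e (prev j)).1, (e (prev j)).2.1), (e j).1)) (by fun_prop)

end OneEpisode

section Deviation

theorem lintegral_pi_prod {ι : Type*} [Fintype ι] {X : ι → Type*} [∀ i, MeasurableSpace (X i)]
    (ν : ∀ i, Measure (X i)) [∀ i, IsProbabilityMeasure (ν i)] (F : ∀ i, X i → ENNReal)
    (hF : ∀ i, Measurable (F i)) :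
    ∫⁻ r, ∏ i, F i (r i) ∂(Measure.pi ν) = ∏ i, ∫⁻ y, F i y ∂(ν i) := by
  have h := lintegral_prod_eq_prod_lintegral_of_indepFun (μ := Measure.pi ν) Finset.univ
    (fun i r => F i (r i)) (iIndepFun_pi fun i => (hF i).aemeasurable)
    (fun i => (hF i).comp (measurable_pi_apply i))
  rw [h]
  refine Finset.prod_congr rfl fun i _ => ?_
  exact (measurePreserving_eval ν i).lintegral_comp (hF i)

/-- Hoeffding's lemma. -/
theorem lintegral_exp_sub_mean_le_one {Ω : Type*} [MeasurableSpace Ω] (P : Measure Ω)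
    [IsProbabilityMeasure P] {v : Ω → ℝ} (hv : Measurable v) (hb : ∀ ω, |v ω| ≤ 1) (t : ℝ) :
    ∫⁻ ω, ENNReal.ofReal (Real.exp (t * (v ω - ∫ ω', v ω' ∂P) - t ^ 2 / 2)) ∂P ≤ 1 := by
  have h := hasSubgaussianMGF_of_mem_Icc (μ := P) (X := v) (a := -1) (b := 1) hv.aemeasurable
    (ae_of_all _ fun ω => abs_le.1 (hb ω))
  have h1 := h.mgf_le t
  have hc : ((‖(1 : ℝ) - -1‖₊ / 2) ^ 2 : NNReal) = 1 := by
    have : ‖(1 : ℝ) - -1‖₊ = 2 := by ext; norm_num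
    rw [this]; norm_num
  rw [hc] at h1
  have h2 := h.integrable_exp_mul t
  have e : ∀ ω, Real.exp (t * (v ω - ∫ ω', v ω' ∂P) - t ^ 2 / 2) =
      Real.exp (- (t ^ 2 / 2)) * Real.exp (t * (v ω - ∫ ω', v ω' ∂P)) := fun ω => by
    rw [← Real.exp_add]; ring_nf
  simp_rw [e]
  rw [← ofReal_integral_eq_lintegral_ofReal (h2.const_mul _)
    (ae_of_all _ fun ω => by positivity), integral_const_mul]
  rw [ENNReal.ofReal_le_one]
  unfold mgf at h1
  refine (mul_le_mul_of_nonneg_left h1 (Real.exp_pos _).le).trans (le_of_eq ?_)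
  rw [← Real.exp_add]
  simp

theorem sum_mul_exp_sub_mean_le_one {S : Type*} [Fintype S] (p : stdSimplex ℝ S) {v : S → ℝ}
    (hb : ∀ s, |v s| ≤ 1) (t : ℝ) :
    ∑ y, (p : S → ℝ) y * Real.exp (t * (v y - ∑ z, (p : S → ℝ) z * v z) - t ^ 2 / 2) ≤ 1 := by
  let _ : MeasurableSpace S := ⊤
  have : DiscreteMeasurableSpace S := ⟨fun _ => trivial⟩
  have hp : ∀ y, 0 ≤ (p : S → ℝ) y := p.2.1
  have hp1 : ∑ y, (p : S → ℝ) y = 1 := p.2.2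
  let P : Measure S := ∑ y, ENNReal.ofReal ((p : S → ℝ) y) • Measure.dirac y
  have hP : IsProbabilityMeasure P := by
    constructor
    simp only [P, Measure.finsetSum_apply, Measure.smul_apply, smul_eq_mul, measure_univ, mul_one]
    rw [← ENNReal.ofReal_sum_of_nonneg fun y _ => hp y, hp1, ENNReal.ofReal_one]
  have hI : ∫ ω', v ω' ∂P = ∑ z, (p : S → ℝ) z * v z := by
    rw [integral_finsetSum_measure]
    · refine Finset.sum_congr rfl fun y _ => ?_
      rw [integral_smul_measure, integral_dirac, ENNReal.toReal_ofReal (hp y), smul_eq_mul]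
    · intro y _
      exact Integrable.smul_measure (integrable_dirac (by simp)) ENNReal.ofReal_ne_top
  have h := lintegral_exp_sub_mean_le_one P (v := v) (measurable_of_countable _) hb t
  rw [hI, lintegral_finsetSum_measure] at h
  simp_rw [lintegral_smul_measure, lintegral_dirac, smul_eq_mul] at h
  simp_rw [← ENNReal.ofReal_mul (hp _)] at h
  rw [← ENNReal.ofReal_sum_of_nonneg fun y _ => mul_nonneg (hp y) (Real.exp_pos _).le,
    ENNReal.ofReal_le_one] at h
  exact h

variable {S A : Type*} [Fintype S] [Fintype A] [MeasurableSpace S] [MeasurableSpace A]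
  [DiscreteMeasurableSpace S] [DiscreteMeasurableSpace A] {τ : ℕ}

theorem lintegral_episodeLaw_prod_le_one (M : MDP S A) (μ : Policy S A τ)
    (G : Option (S × A) → S → ℝ) (hG : ∀ c y, 0 ≤ G c y)
    (hG1 : ∀ c, ∑ y, (M.next c : S → ℝ) y * G c y ≤ 1)
    (H : S × A → unitInterval → ENNReal) (hH : ∀ c, Measurable (H c))
    (hH1 : ∀ c, ∫⁻ r, H c r ∂(M.reward c.1 c.2 : Measure unitInterval) ≤ 1) :
    ∫⁻ e, ENNReal.ofReal (∏ j, G (e.context j) (e j).1) *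
      ∏ j, H (e.stateAction j) (e j).2.2 ∂(M.episodeLaw μ) ≤ 1 := by
  have hHm : Measurable fun p : (S × A) × unitInterval => H p.1 p.2 :=
    measurable_from_prod_countable_right hH
  rw [lintegral_episodeLaw]
  swap
  · refine Measurable.mul (Measurable.ennreal_ofReal ?_) ?_
    · exact Finset.measurable_prod _ fun j _ => measurable_comp_context G j
    · exact Finset.measurable_prod _ fun j _ => hHm.comp
        ((measurable_stateAction j).prodMk (measurable_pi_apply j).snd.snd)
  simp only [context_mk, stateAction_mk]
  have := nonempty_of_MDP M
  calc _ ≤ ∑ x : Fin τ → S, ENNReal.ofReal (∏ j, ((M.next (μ.context j (x (prev j))) : S → ℝ) (x j) *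
        G (μ.context j (x (prev j))) (x j))) := by
        refine Finset.sum_le_sum fun x _ => ?_
        rw [lintegral_const_mul' _ _ ENNReal.ofReal_ne_top, ← mul_assoc,
          ← ENNReal.ofReal_mul (trajProb_nonneg _ _ _), trajProb_eq, ← Finset.prod_mul_distrib,
          lintegral_pi_prod (fun j => (M.reward (x j) (μ j (x j)) : Measure unitInterval))
            (fun j => H (x j, μ j (x j))) fun j => hH _]
        exact mul_le_of_le_one_right' (Finset.prod_le_one' fun j _ => hH1 (x j, μ j (x j)))
    _ = ENNReal.ofReal (∑ x : Fin τ → S,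
        ∏ j, ((M.next (μ.context j (x (prev j))) : S → ℝ) (x j) *
        G (μ.context j (x (prev j))) (x j))) := by
        rw [ENNReal.ofReal_sum_of_nonneg]
        exact fun x _ => Finset.prod_nonneg fun j _ => mul_nonneg ((M.next _).2.1 _) (hG _ _)
    _ ≤ 1 := by
        rw [ENNReal.ofReal_le_one]
        exact sum_prod_step_le_one
          (fun j y y' => (M.next (μ.context j y) : S → ℝ) y' * G (μ.context j y) y')
          (fun j y z => mul_nonneg ((M.next _).2.1 _) (hG _ _)) (fun j y => hG1 _)
          fun j hj y z => by rw [μ.context_zero j hj y z]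

variable [DecidableEq S] [DecidableEq A]

/-- The number of times that a given context occurs in an episode. -/
def transCount (c : Option (S × A)) (e : Episode S A τ) : ℕ :=
  ∑ j, if e.context j = c then 1 else 0

/-- The number of times that a given action is taken in a given state in an episode. -/
def rewardCount (c : S × A) (e : Episode S A τ) : ℕ :=
  ∑ j, if e.stateAction j = c then 1 else 0

/-- The deviation of a test function of the next state from its mean, summed over the occurrences of
a context in an episode. -/
def transDev (c : Option (S × A)) (v : S → ℝ) (M : MDP S A) (e : Episode S A τ) : ℝ :=
  ∑ j, if e.context j = c then v (e j).1 - ∑ y, (M.next c : S → ℝ) y * v y else 0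

/-- The deviation of the (signed) reward from its mean, summed over the occurrences of a state and
an action in an episode. -/
def rewardDev (c : S × A) (σ : ℝ) (M : MDP S A) (e : Episode S A τ) : ℝ :=
  ∑ j, if e.stateAction j = c then σ * (e j).2.2 - σ * M.meanReward c.1 c.2 else 0

theorem lintegral_exp_transDev_le_one (M : MDP S A) (μ : Policy S A τ) (c : Option (S × A))
    {v : S → ℝ} (hv : ∀ s, |v s| ≤ 1) (t : ℝ) :
    ∫⁻ e, ENNReal.ofReal (Real.exp (t * transDev c v M e - t ^ 2 / 2 * transCount c e))
      ∂(M.episodeLaw μ) ≤ 1 := by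
  have h := lintegral_episodeLaw_prod_le_one M μ
    (fun c' y => if c' = c then
      Real.exp (t * (v y - ∑ y, (M.next c : S → ℝ) y * v y) - t ^ 2 / 2) else 1)
    (fun c' y => by split_ifs <;> positivity)
    (fun c' => by
      split_ifs with hc
      · rw [hc]; exact sum_mul_exp_sub_mean_le_one _ hv t
      · simp only [mul_one]; exact (M.next c').2.2.le)
    (fun _ _ => 1) (fun _ => measurable_const) (fun c => by simp)
  refine le_trans (le_of_eq (lintegral_congr fun e => ?_)) h
  simp only [Finset.prod_const_one, mul_one]
  congr 1
  unfold transDev transCount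
  rw [Nat.cast_sum, Finset.mul_sum, Finset.mul_sum, ← Finset.sum_sub_distrib, Real.exp_sum]
  refine Finset.prod_congr rfl fun j _ => ?_
  split_ifs <;> simp

theorem lintegral_exp_rewardDev_le_one (M : MDP S A) (μ : Policy S A τ) (c : S × A)
    {σ : ℝ} (hσ : |σ| ≤ 1) (t : ℝ) :
    ∫⁻ e, ENNReal.ofReal (Real.exp (t * rewardDev c σ M e - t ^ 2 / 2 * rewardCount c e))
      ∂(M.episodeLaw μ) ≤ 1 := by
  have hm : Measurable fun r : unitInterval => (r : ℝ) := measurable_subtype_coe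
  have h := lintegral_episodeLaw_prod_le_one M μ (fun _ _ => 1) (fun _ _ => zero_le_one)
    (fun c' => by simp only [mul_one]; exact (M.next c').2.2.le)
    (fun c' r => if c' = c then
      ENNReal.ofReal (Real.exp (t * (σ * r - σ * M.meanReward c.1 c.2) - t ^ 2 / 2)) else 1)
    (fun c' => by split_ifs <;> fun_prop)
    (fun c' => by
      split_ifs with hc
      · rw [hc]
        have := lintegral_exp_sub_mean_le_one (M.reward c.1 c.2 : Measure unitInterval)
          (v := fun r => σ * (r : ℝ)) (by fun_prop)
          (fun r => by
            rw [abs_mul]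
            exact mul_le_one₀ hσ (abs_nonneg _) (by rw [abs_of_nonneg r.2.1]; exact r.2.2)) t
        rw [integral_const_mul] at this
        exact this
      · simp)
  refine le_trans (le_of_eq (lintegral_congr fun e => ?_)) h
  simp only [Finset.prod_const_one, ENNReal.ofReal_one, one_mul]
  unfold rewardDev rewardCount
  rw [Nat.cast_sum, Finset.mul_sum, Finset.mul_sum, ← Finset.sum_sub_distrib, Real.exp_sum,
    ENNReal.ofReal_prod_of_nonneg fun j _ => (Real.exp_pos _).le]
  refine Finset.prod_congr rfl fun j _ => ?_
  split_ifs <;> simp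

end Deviation

section Concentration

variable {S A : Type*} [Fintype S] [Fintype A] [MeasurableSpace S] [MeasurableSpace A]
  [DiscreteMeasurableSpace S] [DiscreteMeasurableSpace A] {τ : ℕ}

theorem extend_castSucc {S A : Type*} {τ k : ℕ} (w : Record S A τ k) (μ : Policy S A τ)
    (e : Episode S A τ) (l : Fin k) : Record.extend w μ e l.castSucc = w l :=
  Fin.snoc_castSucc (α := fun _ => Policy S A τ × Episode S A τ) _ _ _

theorem extend_last {S A : Type*} {τ k : ℕ} (w : Record S A τ k) (μ : Policy S A τ)
    (e : Episode S A τ) : Record.extend w μ e (Fin.last k) = (μ, e) :=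
  Fin.snoc_last (α := fun _ => Policy S A τ × Episode S A τ) _ _

theorem init_extend {S A : Type*} {τ k : ℕ} (w : Record S A τ k) (μ : Policy S A τ)
    (e : Episode S A τ) : (fun l : Fin k => Record.extend w μ e l.castSucc) = w :=
  funext fun l => extend_castSucc w μ e l

theorem lintegral_interactionLaw_succ (f : Measure (MDP S A)) [IsProbabilityMeasure f]
    (π : Algorithm S A τ) (k : ℕ) {F : MDP S A × Record S A τ (k + 1) → ENNReal}
    (hF : Measurable F) :
    ∫⁻ p, F p ∂(interactionLaw f π (k + 1)) =
      ∫⁻ p, ∫⁻ μ, ∫⁻ e, F (p.1, Record.extend p.2 μ e) ∂(p.1.episodeLaw μ)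
        ∂(π.policyDist k p.2.history) ∂(interactionLaw f π k) := by
  have := isProbabilityMeasure_interactionLaw f π k
  have := π.isMarkov k
  have hm : Measurable fun u : ((MDP S A × Record S A τ k) × Policy S A τ) × Episode S A τ =>
      (u.1.1.1, Record.extend u.1.1.2 u.1.2 u.2) := by
    refine measurable_fst.fst.fst.prodMk ?_
    exact measurable_extend.comp
      ((measurable_fst.fst.snd.prodMk measurable_fst.snd).prodMk measurable_snd)
  have hFm : Measurable fun u : ((MDP S A × Record S A τ k) × Policy S A τ) × Episode S A τ =>
      F (u.1.1.1, Record.extend u.1.1.2 u.1.2 u.2) := hF.comp hm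
  rw [interactionLaw, lintegral_map hF hm, Measure.lintegral_compProd hFm,
    Measure.lintegral_compProd]
  · rfl
  · exact hFm.lintegral_kernel_prod_right'

theorem lintegral_interactionLaw_init (f : Measure (MDP S A)) [IsProbabilityMeasure f]
    (π : Algorithm S A τ) (k : ℕ) {F : MDP S A × Record S A τ k → ENNReal}
    (hF : Measurable F) :
    ∫⁻ p, F (p.1, fun l => p.2 l.castSucc) ∂(interactionLaw f π (k + 1)) =
      ∫⁻ p, F p ∂(interactionLaw f π k) := by
  have := π.isMarkov k
  have hFm : Measurable fun p : MDP S A × Record S A τ (k + 1) =>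
      F (p.1, fun l => p.2 l.castSucc) := hF.comp (by fun_prop)
  rw [lintegral_interactionLaw_succ f π k hFm]
  refine lintegral_congr fun p => ?_
  have h1 : ∀ μ : Policy S A τ, (p.1.episodeLaw μ) Set.univ = 1 := fun μ =>
    (isMarkovKernel_episodeKernel.isProbabilityMeasure (p.1, μ)).measure_univ
  simp only [init_extend, lintegral_const, h1, mul_one, measure_univ]

theorem lintegral_posterior (f : Measure (MDP S A)) [IsProbabilityMeasure f]
    (π : Algorithm S A τ) (k : ℕ) {Q : Kernel (History S A τ k) (MDP S A)}
    (hQ : IsPosterior f π k Q) {g : History S A τ k × MDP S A → ENNReal} (hg : Measurable g) :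
    ∫⁻ p, ∫⁻ M, g (p.2.history, M) ∂(Q p.2.history) ∂(interactionLaw f π k) =
      ∫⁻ p, g (p.2.history, p.1) ∂(interactionLaw f π k) := by
  have := isProbabilityMeasure_interactionLaw f π k
  have := hQ.1
  have hh : Measurable fun p : MDP S A × Record S A τ k => p.2.history :=
    measurable_history.comp measurable_snd
  have : IsProbabilityMeasure ((interactionLaw f π k).map fun p => p.2.history) :=
    Measure.isProbabilityMeasure_map hh.aemeasurable
  have h := congrArg (fun m => ∫⁻ q, g q ∂m) hQ.2
  rw [lintegral_map hg (hh.prodMk measurable_fst), Measure.lintegral_compProd hg,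
    lintegral_map hg.lintegral_kernel_prod_right' hh] at h
  exact h.symm

theorem lintegral_exp_deviation_le_one (f : Measure (MDP S A)) [IsProbabilityMeasure f]
    (π : Algorithm S A τ) {n : Episode S A τ → ℕ} (hn : Measurable n)
    {d : MDP S A → Episode S A τ → ℝ} (hd : Measurable fun q : MDP S A × Episode S A τ => d q.1 q.2)
    (t : ℝ) (h : ∀ M μ, ∫⁻ e, ENNReal.ofReal (Real.exp (t * d M e - t ^ 2 / 2 * n e))
      ∂(M.episodeLaw μ) ≤ 1) :
    ∀ k, ∫⁻ p, ENNReal.ofReal (Real.exp (t * ∑ l, d p.1 (p.2.history l) -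
      t ^ 2 / 2 * ((∑ l, n (p.2.history l) : ℕ) : ℝ))) ∂(interactionLaw f π k) ≤ 1
  | 0 => by
    have := isProbabilityMeasure_interactionLaw f π 0
    simp
  | k + 1 => by
    have := π.isMarkov k
    have hm : ∀ k, Measurable fun p : MDP S A × Record S A τ k =>
        t * ∑ l, d p.1 (p.2.history l) - t ^ 2 / 2 * ((∑ l, n (p.2.history l) : ℕ) : ℝ) := by
      intro k
      have h1 : ∀ l : Fin k, Measurable fun p : MDP S A × Record S A τ k => p.2.history l :=
        fun l => ((measurable_pi_apply l).comp measurable_history).comp measurable_snd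
      refine Measurable.sub ?_ ?_
      · exact (Finset.measurable_sum _ fun l _ =>
          hd.comp (measurable_fst.prodMk (h1 l))).const_mul _
      · exact (measurable_from_nat.comp
          (Finset.measurable_sum _ fun l _ => hn.comp (h1 l))).const_mul _
    rw [lintegral_interactionLaw_succ f π k (hm _).exp.ennreal_ofReal]
    refine (lintegral_mono fun p => ?_).trans (lintegral_exp_deviation_le_one f π hn hd t h k)
    have e : ∀ (μ : Policy S A τ) (e : Episode S A τ),
        ENNReal.ofReal (Real.exp (t * ∑ l, d p.1 ((Record.extend p.2 μ e).history l) -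
          t ^ 2 / 2 * ((∑ l, n ((Record.extend p.2 μ e).history l) : ℕ) : ℝ))) =
        ENNReal.ofReal (Real.exp (t * ∑ l, d p.1 (p.2.history l) -
          t ^ 2 / 2 * ((∑ l, n (p.2.history l) : ℕ) : ℝ))) *
        ENNReal.ofReal (Real.exp (t * d p.1 e - t ^ 2 / 2 * n e)) := by
      intro μ e
      rw [← ENNReal.ofReal_mul (Real.exp_pos _).le, ← Real.exp_add]
      simp only [Fin.sum_univ_castSucc, Record.history, extend_castSucc, extend_last]
      congr 2
      push_cast
      ring
    simp only [e]
    calc _ ≤ ∫⁻ _, ENNReal.ofReal (Real.exp (t * ∑ l, d p.1 (p.2.history l) -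
          t ^ 2 / 2 * ((∑ l, n (p.2.history l) : ℕ) : ℝ))) ∂(π.policyDist k p.2.history) := by
          refine lintegral_mono fun μ => ?_
          rw [lintegral_const_mul' _ _ ENNReal.ofReal_ne_top]
          exact mul_le_of_le_one_right' (h _ _)
      _ = _ := by simp

/-- A self-normalized concentration inequality, uniform over the number of occurrences. -/
theorem interactionLaw_deviation_le (f : Measure (MDP S A)) [IsProbabilityMeasure f]
    (π : Algorithm S A τ) {n : Episode S A τ → ℕ} (hn : Measurable n) (hnτ : ∀ e, n e ≤ τ)
    {d : MDP S A → Episode S A τ → ℝ} (hd : Measurable fun q : MDP S A × Episode S A τ => d q.1 q.2)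
    (h : ∀ t M μ, ∫⁻ e, ENNReal.ofReal (Real.exp (t * d M e - t ^ 2 / 2 * n e))
      ∂(M.episodeLaw μ) ≤ 1) (k : ℕ) {L : ℝ} (hL : 0 ≤ L) :
    interactionLaw f π k {p | 0 < ∑ l, n (p.2.history l) ∧
        √(2 * ((∑ l, n (p.2.history l) : ℕ) : ℝ) * L) < ∑ l, d p.1 (p.2.history l)} ≤
      ENNReal.ofReal (k * τ * Real.exp (-L)) := by
  set P := interactionLaw f π k
  let D : MDP S A × Record S A τ k → ℝ := fun p => ∑ l, d p.1 (p.2.history l)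
  let N : MDP S A × Record S A τ k → ℕ := fun p => ∑ l, n (p.2.history l)
  have hN : ∀ p, N p ≤ k * τ := fun p => by
    refine (Finset.sum_le_sum fun l _ => hnτ _).trans ?_
    simp
  have hsub : {p | 0 < N p ∧ √(2 * (N p : ℝ) * L) < D p} ⊆
      ⋃ m ∈ Finset.Icc 1 (k * τ), {p | N p = m ∧ √(2 * (m : ℝ) * L) ≤ D p} := by
    rintro p ⟨h1, h2⟩
    simp only [Set.mem_iUnion]
    exact ⟨N p, Finset.mem_Icc.2 ⟨h1, hN p⟩, rfl, h2.le⟩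
  have hone : ∀ m ∈ Finset.Icc 1 (k * τ), P {p | N p = m ∧ √(2 * (m : ℝ) * L) ≤ D p} ≤
      ENNReal.ofReal (Real.exp (-L)) := by
    intro m hm
    have hm0 : (0 : ℝ) < m := by exact_mod_cast (Finset.mem_Icc.1 hm).1
    set t := √(2 * L / m)
    have ht0 : 0 ≤ t := Real.sqrt_nonneg _
    have ht2 : t ^ 2 = 2 * L / m := Real.sq_sqrt (by positivity)
    have htm : t * √(2 * (m : ℝ) * L) = 2 * L := by
      rw [← Real.sqrt_mul (by positivity)]
      rw [show 2 * L / m * (2 * m * L) = (2 * L) ^ 2 by field_simp]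
      exact Real.sqrt_sq (by positivity)
    have hle : ∀ p, p ∈ {p | N p = m ∧ √(2 * (m : ℝ) * L) ≤ D p} →
        ENNReal.ofReal (Real.exp L) ≤
          ENNReal.ofReal (Real.exp (t * D p - t ^ 2 / 2 * (N p : ℝ))) := by
      rintro p ⟨h1, h2⟩
      refine ENNReal.ofReal_le_ofReal (Real.exp_le_exp.2 ?_)
      rw [h1, ht2]
      have := mul_le_mul_of_nonneg_left h2 ht0
      rw [htm] at this
      have e : 2 * L / m / 2 * m = L := by field_simp
      rw [e]; linarith
    have h1 := lintegral_exp_deviation_le_one f π hn hd t (h t) k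
    have h2 := meas_le_lintegral₀ (μ := P) (s := {p | N p = m ∧ √(2 * (m : ℝ) * L) ≤ D p})
      (f := fun p => ENNReal.ofReal (Real.exp (-L)) *
        ENNReal.ofReal (Real.exp (t * D p - t ^ 2 / 2 * (N p : ℝ)))) ?_ ?_
    · rw [lintegral_const_mul' _ _ ENNReal.ofReal_ne_top] at h2
      exact h2.trans (mul_le_of_le_one_right' h1)
    · refine Measurable.aemeasurable ?_
      have h1 : ∀ l : Fin k, Measurable fun p : MDP S A × Record S A τ k => p.2.history l :=
        fun l => ((measurable_pi_apply l).comp measurable_history).comp measurable_snd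
      have hD : Measurable D := Finset.measurable_sum _ fun l _ =>
          hd.comp (measurable_fst.prodMk (h1 l))
      have hN : Measurable fun p => (N p : ℝ) := measurable_from_nat.comp
          (Finset.measurable_sum _ fun l _ => hn.comp (h1 l))
      fun_prop
    · intro p hp
      refine le_trans ?_ (mul_le_mul_right (hle p hp) _)
      rw [← ENNReal.ofReal_mul (Real.exp_pos _).le, ← Real.exp_add]
      simp
  calc _ ≤ P (⋃ m ∈ Finset.Icc 1 (k * τ), {p | N p = m ∧ √(2 * (m : ℝ) * L) ≤ D p}) :=
        measure_mono hsub
    _ ≤ ∑ m ∈ Finset.Icc 1 (k * τ), P {p | N p = m ∧ √(2 * (m : ℝ) * L) ≤ D p} :=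
        measure_biUnion_finset_le _ _
    _ ≤ ∑ m ∈ Finset.Icc 1 (k * τ), ENNReal.ofReal (Real.exp (-L)) := Finset.sum_le_sum hone
    _ = _ := by
        rw [Finset.sum_const, Nat.card_Icc, ENNReal.ofReal_mul (by positivity), nsmul_eq_mul]
        congr 1
        rw [← Nat.cast_mul, ENNReal.ofReal_natCast]
        simp

end Concentration

section Accuracy

/-- The sign encoded by a Boolean. -/
def boolSign (b : Bool) : ℝ := if b then 1 else -1

theorem abs_boolSign (b : Bool) : |boolSign b| ≤ 1 := by cases b <;> simp [boolSign]

theorem boolSign_not (b : Bool) : boolSign (!b) = -boolSign b := by cases b <;> simp [boolSign]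

theorem exists_boolSign_mul_eq_abs (x : ℝ) : ∃ b, boolSign b * x = |x| := by
  rcases le_total 0 x with h | h
  · exact ⟨true, by simp [boolSign, abs_of_nonneg h]⟩
  · exact ⟨false, by simp [boolSign, abs_of_nonpos h]⟩

/-- The width of a confidence interval based on `N` samples. -/
def confWidth (L : ℝ) (N : ℕ) : ℝ := if N = 0 then 2 else min 2 (2 * √(2 * L / N))

theorem confWidth_nonneg (L : ℝ) (N : ℕ) : 0 ≤ confWidth L N := by
  unfold confWidth; split_ifs <;> positivity

theorem confWidth_le_two (L : ℝ) (N : ℕ) : confWidth L N ≤ 2 := by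
  unfold confWidth
  split_ifs
  · exact le_rfl
  · exact min_le_left _ _

theorem le_confWidth {L D : ℝ} {N : ℕ} (hD : D ≤ 2)
    (h : 0 < N → N * D ≤ 2 * √(2 * N * L)) : D ≤ confWidth L N := by
  unfold confWidth
  split_ifs with hN
  · exact hD
  · refine le_min hD ?_
    have hN0 : (0 : ℝ) < N := by exact_mod_cast Nat.pos_of_ne_zero hN
    have h1 := h (Nat.pos_of_ne_zero hN)
    have e : √(2 * N * L) = N * √(2 * L / N) := by
      rw [show (2 * N * L : ℝ) = (N : ℝ) ^ 2 * (2 * L / N) by field_simp,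
        Real.sqrt_mul (by positivity), Real.sqrt_sq hN0.le]
    rw [e] at h1
    exact le_of_mul_le_mul_left (by linarith) hN0

variable {S A : Type*} {τ : ℕ}

theorem transCount_le [DecidableEq S] [DecidableEq A] (c : Option (S × A))
    (e : Episode S A τ) : transCount c e ≤ τ := by
  unfold transCount
  refine (Finset.sum_le_sum (g := fun _ => 1) fun j _ => ?_).trans (by simp)
  split_ifs <;> simp

theorem rewardCount_le [DecidableEq S] [DecidableEq A] (c : S × A)
    (e : Episode S A τ) : rewardCount c e ≤ τ := by
  unfold rewardCount
  refine (Finset.sum_le_sum (g := fun _ => 1) fun j _ => ?_).trans (by simp)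
  split_ifs <;> simp

variable [Fintype S]

theorem transDist_le_two (M M' : MDP S A) (c : Option (S × A)) : transDist M M' c ≤ 2 := by
  have h1 : ∑ y, (M.next c : S → ℝ) y = 1 := (M.next c).2.2
  have h2 : ∑ y, (M'.next c : S → ℝ) y = 1 := (M'.next c).2.2
  have h1' : ∀ y, 0 ≤ (M.next c : S → ℝ) y := (M.next c).2.1
  have h2' : ∀ y, 0 ≤ (M'.next c : S → ℝ) y := (M'.next c).2.1
  calc transDist M M' c ≤ ∑ y, ((M'.next c : S → ℝ) y + (M.next c : S → ℝ) y) := by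
        refine Finset.sum_le_sum fun y _ => (abs_sub _ _).trans (le_of_eq ?_)
        rw [abs_of_nonneg (h1' y), abs_of_nonneg (h2' y)]
    _ = 2 := by rw [Finset.sum_add_distrib, h1, h2]; norm_num

theorem rewardDist_le_two (M M' : MDP S A) (c : S × A) : rewardDist M M' c ≤ 2 := by
  have h1 := meanReward_nonneg M c.1 c.2
  have h2 := meanReward_nonneg M' c.1 c.2
  have h3 := meanReward_le_one M c.1 c.2
  have h4 := meanReward_le_one M' c.1 c.2
  exact abs_le.2 ⟨by linarith, by linarith⟩

variable [DecidableEq S] [DecidableEq A]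

theorem transDev_eq (c : Option (S × A)) (v : S → ℝ) (M : MDP S A) (e : Episode S A τ) :
    transDev c v M e = (∑ j, if e.context j = c then v (e j).1 else 0) -
      transCount c e * ∑ y, (M.next c : S → ℝ) y * v y := by
  unfold transDev transCount
  rw [Nat.cast_sum, Finset.sum_mul, ← Finset.sum_sub_distrib]
  refine Finset.sum_congr rfl fun j _ => ?_
  split_ifs <;> simp

theorem rewardDev_eq (c : S × A) (σ : ℝ) (M : MDP S A) (e : Episode S A τ) :
    rewardDev c σ M e = σ * (∑ j, if e.stateAction j = c then ((e j).2.2 : ℝ) else 0) -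
      rewardCount c e * (σ * M.meanReward c.1 c.2) := by
  unfold rewardDev rewardCount
  rw [Nat.cast_sum, Finset.sum_mul, Finset.mul_sum, ← Finset.sum_sub_distrib]
  refine Finset.sum_congr rfl fun j _ => ?_
  split_ifs <;> simp

/-- `M` fits the observations `h`: all empirical sums lie in confidence intervals around their
means. -/
def IsAccurate (L : ℝ) (M : MDP S A) {k : ℕ} (h : History S A τ k) : Prop :=
  (∀ (c : Option (S × A)) (v : S → Bool), 0 < ∑ l, transCount c (h l) →
    ∑ l, transDev c (fun s => boolSign (v s)) M (h l) ≤
      √(2 * ((∑ l, transCount c (h l) : ℕ) : ℝ) * L)) ∧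
  (∀ (c : S × A) (b : Bool), 0 < ∑ l, rewardCount c (h l) →
    ∑ l, rewardDev c (boolSign b) M (h l) ≤ √(2 * ((∑ l, rewardCount c (h l) : ℕ) : ℝ) * L))

theorem transDist_le_confWidth {L : ℝ} {M M' : MDP S A} {k : ℕ} {h : History S A τ k}
    (hM : IsAccurate L M h) (hM' : IsAccurate L M' h) (c : Option (S × A)) :
    transDist M M' c ≤ confWidth L (∑ l, transCount c (h l)) := by
  refine le_confWidth (transDist_le_two M M' c) fun hN => ?_
  choose v hv using fun y =>
    exists_boolSign_mul_eq_abs ((M'.next c : S → ℝ) y - (M.next c : S → ℝ) y)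
  have h1 := hM.1 c v hN
  have h2 := hM'.1 c (fun s => !(v s)) hN
  have e : transDist M M' c = ∑ y, (M'.next c : S → ℝ) y * boolSign (v y) -
      ∑ y, (M.next c : S → ℝ) y * boolSign (v y) := by
    unfold transDist
    rw [← Finset.sum_sub_distrib]
    exact Finset.sum_congr rfl fun y _ => by rw [← hv]; ring
  have e1 : ∀ e : Episode S A τ, transDev c (fun s => boolSign (v s)) M e +
      transDev c (fun s => boolSign (!(v s))) M' e = transCount c e * transDist M M' c := by
    intro e'
    rw [transDev_eq, transDev_eq, e]
    simp only [boolSign_not, mul_neg, Finset.sum_neg_distrib]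
    have : (∑ j, if e'.context j = c then -boolSign (v (e' j).1) else 0) =
        -∑ j, if e'.context j = c then boolSign (v (e' j).1) else 0 := by
      rw [← Finset.sum_neg_distrib]
      exact Finset.sum_congr rfl fun j _ => by split_ifs <;> simp
    rw [this]
    ring
  have e2 := Finset.sum_congr (rfl : (Finset.univ : Finset (Fin k)) = _) fun l _ => e1 (h l)
  rw [Finset.sum_add_distrib, ← Finset.sum_mul, ← Nat.cast_sum] at e2
  linarith

theorem rewardDist_le_confWidth {L : ℝ} {M M' : MDP S A} {k : ℕ} {h : History S A τ k}
    (hM : IsAccurate L M h) (hM' : IsAccurate L M' h) (c : S × A) :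
    rewardDist M M' c ≤ confWidth L (∑ l, rewardCount c (h l)) := by
  refine le_confWidth (rewardDist_le_two M M' c) fun hN => ?_
  obtain ⟨b, hb⟩ := exists_boolSign_mul_eq_abs (M'.meanReward c.1 c.2 - M.meanReward c.1 c.2)
  have h1 := hM.2 c b hN
  have h2 := hM'.2 c (!b) hN
  have e1 : ∀ e : Episode S A τ, rewardDev c (boolSign b) M e +
      rewardDev c (boolSign !b) M' e = rewardCount c e * rewardDist M M' c := by
    intro e'
    rw [rewardDev_eq, rewardDev_eq, rewardDist, ← hb, boolSign_not]
    ring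
  have e2 := Finset.sum_congr (rfl : (Finset.univ : Finset (Fin k)) = _) fun l _ => e1 (h l)
  rw [Finset.sum_add_distrib, ← Finset.sum_mul, ← Nat.cast_sum] at e2
  linarith

/-- A bound on the loss in an episode due to the uncertainty that remains after `h`. -/
def episodeBonus [Fintype A] (L : ℝ) {k : ℕ} (h : History S A τ k) (e : Episode S A τ) : ℝ :=
  τ * (∑ c, transCount c e * confWidth L (∑ l, transCount c (h l))) +
    ∑ c, rewardCount c e * confWidth L (∑ l, rewardCount c (h l))

theorem episodeBonus_eq [Fintype A] (L : ℝ) {k : ℕ} (h : History S A τ k) (e : Episode S A τ) :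
    episodeBonus L h e = τ * (∑ j, confWidth L (∑ l, transCount (e.context j) (h l))) +
      ∑ j, confWidth L (∑ l, rewardCount (e.stateAction j) (h l)) := by
  unfold episodeBonus
  conv_lhs => unfold transCount rewardCount
  simp only [Nat.cast_sum, Finset.sum_mul]
  rw [Finset.sum_comm, Finset.sum_comm (s := (Finset.univ : Finset (S × A)))]
  simp only [Nat.cast_ite, Nat.cast_one, Nat.cast_zero, ite_mul, one_mul, zero_mul,
    Finset.sum_ite_eq, Finset.mem_univ, if_true]
  rfl

theorem episodeBonus_nonneg [Fintype A] (L : ℝ) {k : ℕ} (h : History S A τ k)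
    (e : Episode S A τ) : 0 ≤ episodeBonus L h e := by
  unfold episodeBonus
  have := confWidth_nonneg L
  refine add_nonneg (mul_nonneg (Nat.cast_nonneg _) ?_) ?_ <;>
    exact Finset.sum_nonneg fun c _ => mul_nonneg (Nat.cast_nonneg _) (this _)

variable [Fintype A] [MeasurableSpace S] [MeasurableSpace A]
  [DiscreteMeasurableSpace S] [DiscreteMeasurableSpace A]

@[fun_prop]
theorem measurable_transCount (c : Option (S × A)) :
    Measurable (transCount c : Episode S A τ → ℕ) :=
  Finset.measurable_sum _ fun j _ =>
    measurable_comp_context (fun c' _ => if c' = c then 1 else 0) j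

@[fun_prop]
theorem measurable_rewardCount (c : S × A) :
    Measurable (rewardCount c : Episode S A τ → ℕ) :=
  Finset.measurable_sum _ fun j _ =>
    (measurable_of_countable fun c' => if c' = c then 1 else 0).comp (measurable_stateAction j)

theorem measurable_transDev (c : Option (S × A)) (v : S → ℝ) :
    Measurable fun q : MDP S A × Episode S A τ => transDev c v q.1 q.2 := by
  simp only [transDev_eq]
  refine Measurable.sub ?_ (Measurable.mul ?_ ?_)
  · exact Finset.measurable_sum _ fun j _ =>
      (measurable_comp_context (fun c' y => if c' = c then v y else 0) j).comp measurable_snd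
  · exact measurable_from_nat.comp ((measurable_transCount c).comp measurable_snd)
  · exact Finset.measurable_sum _ fun y _ =>
      ((measurable_next c y).comp measurable_fst).mul_const _

theorem measurable_rewardDev (c : S × A) (σ : ℝ) :
    Measurable fun q : MDP S A × Episode S A τ => rewardDev c σ q.1 q.2 := by
  simp only [rewardDev_eq]
  refine Measurable.sub (Measurable.const_mul ?_ _) (Measurable.mul ?_ (Measurable.const_mul ?_ _))
  · refine Finset.measurable_sum _ fun j _ => Measurable.ite ?_ ?_ measurable_const
    · exact ((measurable_stateAction j).comp measurable_snd) (measurableSet_singleton c)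
    · exact measurable_subtype_coe.comp ((measurable_pi_apply j).comp measurable_snd).snd.snd
  · exact measurable_from_nat.comp ((measurable_rewardCount c).comp measurable_snd)
  · exact (measurable_meanReward _ _).comp measurable_fst

theorem measurable_sum_transCount (c : Option (S × A)) (k : ℕ) :
    Measurable fun h : History S A τ k => ∑ l, transCount c (h l) :=
  Finset.measurable_sum _ fun l _ => (measurable_transCount c).comp (measurable_pi_apply l)

theorem measurable_sum_rewardCount (c : S × A) (k : ℕ) :
    Measurable fun h : History S A τ k => ∑ l, rewardCount c (h l) :=
  Finset.measurable_sum _ fun l _ => (measurable_rewardCount c).comp (measurable_pi_apply l)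

theorem measurable_deviation_le (L : ℝ) {k : ℕ} {n : Episode S A τ → ℕ} (hn : Measurable n)
    {d : MDP S A → Episode S A τ → ℝ}
    (hd : Measurable fun q : MDP S A × Episode S A τ => d q.1 q.2) :
    Measurable fun q : History S A τ k × MDP S A => 0 < ∑ l, n (q.1 l) →
      ∑ l, d q.2 (q.1 l) ≤ √(2 * ((∑ l, n (q.1 l) : ℕ) : ℝ) * L) := by
  have hN : Measurable fun q : History S A τ k × MDP S A => ∑ l, n (q.1 l) :=
    Finset.measurable_sum _ fun l _ => hn.comp ((measurable_pi_apply l).comp measurable_fst)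
  have hD : Measurable fun q : History S A τ k × MDP S A => ∑ l, d q.2 (q.1 l) :=
    Finset.measurable_sum _ fun l _ =>
      hd.comp (measurable_snd.prodMk ((measurable_pi_apply l).comp measurable_fst))
  have hw : Measurable fun q : History S A τ k × MDP S A =>
      √(2 * ((∑ l, n (q.1 l) : ℕ) : ℝ) * L) :=
    (measurable_from_nat (f := fun n : ℕ => √(2 * (n : ℝ) * L))).comp hN
  have h1 := measurableSet_setOfPred.1 (hN (measurableSet_Ioi (a := 0)))
  exact h1.imp (measurableSet_setOfPred.1 (measurableSet_le hD hw))

theorem measurableSet_isAccurate (L : ℝ) (k : ℕ) :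
    MeasurableSet {q : History S A τ k × MDP S A | IsAccurate L q.2 q.1} := by
  unfold IsAccurate
  rw [measurableSet_setOfPred]
  refine Measurable.and ?_ ?_
  · refine Measurable.forall fun c => Measurable.forall fun v => ?_
    exact measurable_deviation_le L (measurable_transCount c) (measurable_transDev c _)
  · refine Measurable.forall fun c => Measurable.forall fun b => ?_
    exact measurable_deviation_le L (measurable_rewardCount c) (measurable_rewardDev c _)

theorem measurable_episodeBonus (L : ℝ) (k : ℕ) :
    Measurable fun q : History S A τ k × Episode S A τ => episodeBonus L q.1 q.2 := by
  unfold episodeBonus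
  refine Measurable.add (Measurable.const_mul ?_ _) ?_
  · refine Finset.measurable_sum _ fun c _ => Measurable.mul ?_ ?_
    · exact measurable_from_nat.comp ((measurable_transCount c).comp measurable_snd)
    · exact (measurable_from_nat (f := confWidth L)).comp ((measurable_sum_transCount c k).comp measurable_fst)
  · refine Finset.measurable_sum _ fun c _ => Measurable.mul ?_ ?_
    · exact measurable_from_nat.comp ((measurable_rewardCount c).comp measurable_snd)
    · exact (measurable_from_nat (f := confWidth L)).comp ((measurable_sum_rewardCount c k).comp measurable_fst)

/-- A bound on the probability that the true MDP does not fit the observations. -/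
def failureBound (S A : Type*) [Fintype S] [Fintype A] (τ : ℕ) (L : ℝ) (k : ℕ) : ℝ :=
  (Fintype.card (Option (S × A)) * 2 ^ Fintype.card S + Fintype.card (S × A) * 2) *
    (k * τ * Real.exp (-L))

theorem interactionLaw_not_isAccurate_le (f : Measure (MDP S A)) [IsProbabilityMeasure f]
    (π : Algorithm S A τ) (k : ℕ) {L : ℝ} (hL : 0 ≤ L) :
    interactionLaw f π k {p | ¬ IsAccurate L p.1 p.2.history} ≤
      ENNReal.ofReal (failureBound S A τ L k) := by
  have hsub : {p : MDP S A × Record S A τ k | ¬ IsAccurate L p.1 p.2.history} ⊆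
      (⋃ q : Option (S × A) × (S → Bool), {p | 0 < ∑ l, transCount q.1 (p.2.history l) ∧
        √(2 * ((∑ l, transCount q.1 (p.2.history l) : ℕ) : ℝ) * L) <
          ∑ l, transDev q.1 (fun s => boolSign (q.2 s)) p.1 (p.2.history l)}) ∪
      ⋃ q : (S × A) × Bool, {p | 0 < ∑ l, rewardCount q.1 (p.2.history l) ∧
        √(2 * ((∑ l, rewardCount q.1 (p.2.history l) : ℕ) : ℝ) * L) <
          ∑ l, rewardDev q.1 (boolSign q.2) p.1 (p.2.history l)} := by
    intro p hp
    simp only [Set.mem_ofPred_eq, IsAccurate, not_and_or, not_forall, not_le] at hp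
    rcases hp with ⟨c, v, h1, h2⟩ | ⟨c, v, h1, h2⟩
    · exact Or.inl (Set.mem_iUnion.2 ⟨(c, v), h1, h2⟩)
    · exact Or.inr (Set.mem_iUnion.2 ⟨(c, v), h1, h2⟩)
  refine (measure_mono hsub).trans ((measure_union_le _ _).trans ?_)
  have h1 := fun q : Option (S × A) × (S → Bool) => interactionLaw_deviation_le f π
    (measurable_transCount q.1) (transCount_le q.1)
    (measurable_transDev q.1 fun s => boolSign (q.2 s))
    (fun t M μ => lintegral_exp_transDev_le_one M μ q.1 (fun s => abs_boolSign (q.2 s)) t) k hL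
  have h2 := fun q : (S × A) × Bool => interactionLaw_deviation_le f π
    (measurable_rewardCount q.1) (rewardCount_le q.1)
    (measurable_rewardDev q.1 (boolSign q.2))
    (fun t M μ => lintegral_exp_rewardDev_le_one M μ q.1 (abs_boolSign q.2) t) k hL
  have h3 := (measure_iUnion_fintype_le _ _).trans (Finset.sum_le_sum fun q _ => h1 q)
  have h4 := (measure_iUnion_fintype_le _ _).trans (Finset.sum_le_sum fun q _ => h2 q)
  refine (add_le_add h3 h4).trans (le_of_eq ?_)
  simp only [Finset.sum_const, Finset.card_univ, nsmul_eq_mul]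
  rw [← ENNReal.ofReal_natCast, ← ENNReal.ofReal_natCast, ← ENNReal.ofReal_mul (by positivity),
    ← ENNReal.ofReal_mul (by positivity), ← ENNReal.ofReal_add (by positivity) (by positivity)]
  congr 1
  unfold failureBound
  rw [Fintype.card_prod (Option (S × A)), Fintype.card_prod (S × A) Bool, Fintype.card_fun,
    Fintype.card_bool]
  push_cast
  ring

end Accuracy

section Regret

variable {S A : Type*} [Fintype S] [DecidableEq S] [Fintype A]
  [MeasurableSpace S] [DiscreteMeasurableSpace S]
  [MeasurableSpace A] [DiscreteMeasurableSpace A] {τ : ℕ}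

theorem episodeRegret_eq {S A : Type*} [Fintype S] [DecidableEq S] {τ : ℕ} [NeZero τ]
    (opt : MDP S A → Policy S A τ) (M : MDP S A) (μ : Policy S A τ) :
    episodeRegret opt M μ = M.expectedReward (opt M) - M.expectedReward μ := by
  unfold episodeRegret
  simp_rw [mul_sub]
  rw [Finset.sum_sub_distrib, sum_init_mul_value, sum_init_mul_value]

theorem expectedReward_le_of_isOptimal {S A : Type*} [Fintype S] [DecidableEq S] {τ : ℕ} [NeZero τ]
    {M : MDP S A} {ν : Policy S A τ} (h : M.IsOptimal ν) (μ : Policy S A τ) :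
    M.expectedReward μ ≤ M.expectedReward ν := by
  rw [← sum_init_mul_value, ← sum_init_mul_value]
  exact Finset.sum_le_sum fun s _ =>
    mul_le_mul_of_nonneg_left ((h 0 s).2 ⟨μ, rfl⟩) (M.init.2.1 s)

theorem episodeRegret_nonneg {S A : Type*} [Fintype S] [DecidableEq S] {τ : ℕ} [NeZero τ]
    {opt : MDP S A → Policy S A τ} (hopt : ∀ M : MDP S A, M.IsOptimal (opt M)) (M : MDP S A)
    (μ : Policy S A τ) : 0 ≤ episodeRegret opt M μ := by
  rw [episodeRegret_eq]
  exact sub_nonneg.2 (expectedReward_le_of_isOptimal (hopt M) μ)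

theorem episodeRegret_le {S A : Type*} [Fintype S] [DecidableEq S] {τ : ℕ} [NeZero τ]
    (opt : MDP S A → Policy S A τ) (M : MDP S A) (μ : Policy S A τ) :
    episodeRegret opt M μ ≤ τ := by
  rw [episodeRegret_eq]
  linarith [expectedReward_le M (opt M), expectedReward_nonneg M μ]

theorem measurable_expectedReward_policy :
    Measurable fun q : MDP S A × Policy S A τ => q.1.expectedReward q.2 :=
  measurable_from_prod_countable_left fun μ => measurable_expectedReward μ

theorem measurable_episodeRegret [NeZero τ] {opt : MDP S A → Policy S A τ} (hm : Measurable opt) :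
    Measurable fun q : MDP S A × Policy S A τ => episodeRegret opt q.1 q.2 := by
  simp_rw [episodeRegret_eq]
  exact (measurable_expectedReward_policy.comp
    (measurable_fst.prodMk (hm.comp measurable_fst))).sub measurable_expectedReward_policy

variable [DecidableEq A]

/-- The set of pairs of a history and an MDP that does not fit it. -/
def inaccurateSet (S A : Type*) [Fintype S] [DecidableEq S] [DecidableEq A] (τ : ℕ) (L : ℝ)
    (k : ℕ) : Set (History S A τ k × MDP S A) :=
  {q | ¬ IsAccurate L q.2 q.1}

theorem measurableSet_inaccurateSet (L : ℝ) (k : ℕ) : MeasurableSet (inaccurateSet S A τ L k) :=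
  (measurableSet_isAccurate L k).compl

theorem ofReal_expectedReward_le (L : ℝ) (M M' : MDP S A) (μ : Policy S A τ) {k : ℕ}
    (h : History S A τ k) :
    ENNReal.ofReal (M'.expectedReward μ) ≤ ENNReal.ofReal (M.expectedReward μ) +
      (∫⁻ e, ENNReal.ofReal (episodeBonus L h e) ∂(M.episodeLaw μ) +
        (τ * (inaccurateSet S A τ L k).indicator 1 (h, M) +
          τ * (inaccurateSet S A τ L k).indicator 1 (h, M'))) := by
  have hτ : ENNReal.ofReal (M'.expectedReward μ) ≤ τ := by
    rw [← ENNReal.ofReal_natCast]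
    exact ENNReal.ofReal_le_ofReal (expectedReward_le _ _)
  by_cases hM : IsAccurate L M h
  swap
  · have h1 : (h, M) ∈ inaccurateSet S A τ L k := hM
    rw [Set.indicator_of_mem h1]
    refine hτ.trans (le_trans ?_ le_add_self)
    refine le_trans ?_ le_add_self
    simp
  by_cases hM' : IsAccurate L M' h
  swap
  · have h1 : (h, M') ∈ inaccurateSet S A τ L k := hM'
    rw [Set.indicator_of_mem h1]
    refine hτ.trans (le_trans ?_ le_add_self)
    refine le_trans ?_ le_add_self
    simp
  have hE : ∫⁻ e, ENNReal.ofReal (episodeBonus L h e) ∂(M.episodeLaw μ) =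
      ENNReal.ofReal (∑ x, M.trajProb μ x *
        (τ * (∑ j, confWidth L (∑ l, transCount (μ.context j (x (prev j))) (h l))) +
          ∑ j, confWidth L (∑ l, rewardCount (x j, μ j (x j)) (h l)))) := by
    have hb : Measurable fun e : Episode S A τ => ENNReal.ofReal (episodeBonus L h e) :=
      ((measurable_episodeBonus L k).comp (measurable_prodMk_left (x := h))).ennreal_ofReal
    rw [lintegral_episodeLaw M μ hb,
      ENNReal.ofReal_sum_of_nonneg]
    · refine Finset.sum_congr rfl fun x _ => ?_
      simp only [episodeBonus_eq, context_mk, stateAction_mk,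
        lintegral_const, measure_univ, mul_one]
      rw [ENNReal.ofReal_mul (trajProb_nonneg _ _ _)]
    · intro x _
      have := confWidth_nonneg L
      refine mul_nonneg (trajProb_nonneg _ _ _) (add_nonneg (mul_nonneg (Nat.cast_nonneg _) ?_) ?_)
      <;> exact Finset.sum_nonneg fun _ _ => this _
  refine le_trans ?_ (add_le_add_right le_self_add _)
  rw [hE]
  refine (ENNReal.ofReal_le_ofReal ?_).trans ENNReal.ofReal_add_le
  rw [← sub_le_iff_le_add']
  refine (expectedReward_sub_le M M' μ).trans (Finset.sum_le_sum fun x _ =>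
    mul_le_mul_of_nonneg_left (add_le_add (mul_le_mul_of_nonneg_left ?_ (Nat.cast_nonneg _)) ?_)
      (trajProb_nonneg _ _ _))
  · exact Finset.sum_le_sum fun j _ => transDist_le_confWidth hM hM' _
  · exact Finset.sum_le_sum fun j _ => rewardDist_le_confWidth hM hM' _

variable [NeZero τ] {opt : MDP S A → Policy S A τ} {f : Measure (MDP S A)}
  [IsProbabilityMeasure f] {π : Algorithm S A τ}

/-- The expected regret of an episode of posterior sampling is bounded by the expected bonus. -/
theorem lintegral_episodeRegret_le (hm : Measurable opt) (hopt : ∀ M : MDP S A, M.IsOptimal (opt M))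
    (hπ : IsPosteriorSampling opt f π) (k : ℕ) {L : ℝ} (hL : 0 ≤ L) :
    ∫⁻ p, ∫⁻ μ, ENNReal.ofReal (episodeRegret opt p.1 μ) ∂(π.policyDist k p.2.history)
      ∂(interactionLaw f π k) ≤
    ∫⁻ p, ∫⁻ μ, ∫⁻ e, ENNReal.ofReal (episodeBonus L p.2.history e) ∂(p.1.episodeLaw μ)
      ∂(π.policyDist k p.2.history) ∂(interactionLaw f π k) +
      2 * τ * ENNReal.ofReal (failureBound S A τ L k) := by
  obtain ⟨Q, hQ, hπQ⟩ := hπ k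
  have := hQ.1
  have := isProbabilityMeasure_interactionLaw f π k
  set P := interactionLaw f π k
  have hh : Measurable fun p : MDP S A × Record S A τ k => p.2.history :=
    measurable_history.comp measurable_snd
  let ρ := P ⊗ₘ Q.comap (fun p : MDP S A × Record S A τ k => p.2.history) hh
  have hR : ∀ {F : (MDP S A × Record S A τ k) × MDP S A → ENNReal}, Measurable F →
      ∫⁻ q, F q ∂ρ = ∫⁻ p, ∫⁻ M', F (p, M') ∂(Q p.2.history) ∂P := fun hF => by
    rw [Measure.lintegral_compProd hF]; rfl
  have hRfst : ∀ {F : MDP S A × Record S A τ k → ENNReal}, Measurable F →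
      ∫⁻ q, F q.1 ∂ρ = ∫⁻ p, F p ∂P := fun {F} hF => by
    rw [hR (F := fun q => F q.1) (hF.comp measurable_fst)]; simp
  have hRpost : ∀ {g : History S A τ k × MDP S A → ENNReal}, Measurable g →
      ∫⁻ q, g (q.1.2.history, q.2) ∂ρ = ∫⁻ p, g (p.2.history, p.1) ∂P := fun {g} hg => by
    rw [← lintegral_posterior f π k hQ hg, hR (F := fun q => g (q.1.2.history, q.2))
      (hg.comp ((hh.comp measurable_fst).prodMk measurable_snd))]
  have hJ := measurable_expectedReward_policy (S := S) (A := A) (τ := τ)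
  have hJo : Measurable fun M : MDP S A => ENNReal.ofReal (M.expectedReward (opt M)) :=
    (hJ.comp (measurable_id.prodMk hm)).ennreal_ofReal
  have hJs : Measurable fun q : (MDP S A × Record S A τ k) × MDP S A =>
      ENNReal.ofReal (q.1.1.expectedReward (opt q.2)) :=
    (hJ.comp (measurable_fst.fst.prodMk (hm.comp measurable_snd))).ennreal_ofReal
  have hreg : Measurable fun q : (MDP S A × Record S A τ k) × MDP S A =>
      ENNReal.ofReal (episodeRegret opt q.1.1 (opt q.2)) :=
    ((measurable_episodeRegret hm).comp
      (measurable_fst.fst.prodMk (hm.comp measurable_snd))).ennreal_ofReal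
  have hbon : Measurable fun q : (MDP S A × Record S A τ k) × MDP S A =>
      ∫⁻ e, ENNReal.ofReal (episodeBonus L q.1.2.history e) ∂(q.1.1.episodeLaw (opt q.2)) := by
    have hF : Measurable fun u : ((MDP S A × Record S A τ k) × MDP S A) × Episode S A τ =>
        ENNReal.ofReal (episodeBonus L u.1.1.2.history u.2) :=
      ((measurable_episodeBonus L k).comp
        ((hh.comp measurable_fst.fst).prodMk measurable_snd)).ennreal_ofReal
    exact hF.lintegral_kernel_prod_right' (κ := (episodeKernel S A τ).comap
      (fun q : (MDP S A × Record S A τ k) × MDP S A => (q.1.1, opt q.2))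
      (measurable_fst.fst.prodMk (hm.comp measurable_snd)))
  have hind : Measurable ((inaccurateSet S A τ L k).indicator (1 : History S A τ k × MDP S A → ENNReal)) :=
    measurable_one.indicator (measurableSet_inaccurateSet L k)
  have hswap : ∫⁻ q, ENNReal.ofReal (q.1.1.expectedReward (opt q.1.1)) ∂ρ =
      ∫⁻ q, ENNReal.ofReal (q.2.expectedReward (opt q.2)) ∂ρ := by
    rw [hRfst (F := fun p => ENNReal.ofReal (p.1.expectedReward (opt p.1)))
      (hJo.comp measurable_fst),
      hRpost (g := fun q => ENNReal.ofReal (q.2.expectedReward (opt q.2)))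
        (hJo.comp measurable_snd)]
  have hfail : ∫⁻ p, (inaccurateSet S A τ L k).indicator (1 : History S A τ k × MDP S A → ENNReal) (p.2.history, p.1) ∂P ≤
      ENNReal.ofReal (failureBound S A τ L k) := by
    refine le_trans (le_of_eq ?_) (interactionLaw_not_isAccurate_le f π k hL)
    have hs : MeasurableSet {p : MDP S A × Record S A τ k | ¬ IsAccurate L p.1 p.2.history} :=
      (hh.prodMk measurable_fst) (measurableSet_inaccurateSet L k)
    rw [← lintegral_indicator_one hs]
    rfl
  have hmain : ∫⁻ q, ENNReal.ofReal (episodeRegret opt q.1.1 (opt q.2)) ∂ρ ≤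
      ∫⁻ q, ∫⁻ e, ENNReal.ofReal (episodeBonus L q.1.2.history e) ∂(q.1.1.episodeLaw (opt q.2)) ∂ρ +
      2 * τ * ENNReal.ofReal (failureBound S A τ L k) := by
    have hfin : ∫⁻ q, ENNReal.ofReal (q.1.1.expectedReward (opt q.2)) ∂ρ ≠ ⊤ := by
      refine ne_top_of_le_ne_top ENNReal.ofReal_ne_top
        (b := ENNReal.ofReal (τ : ℝ)) ?_
      refine (lintegral_mono fun q => ENNReal.ofReal_le_ofReal (expectedReward_le _ _)).trans ?_
      simp
    refine (ENNReal.add_le_add_iff_left hfin).1 ?_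
    rw [← lintegral_add_left hJs]
    calc _ = ∫⁻ q, ENNReal.ofReal (q.1.1.expectedReward (opt q.1.1)) ∂ρ := by
          refine lintegral_congr fun q => ?_
          rw [← ENNReal.ofReal_add (expectedReward_nonneg _ _) (episodeRegret_nonneg hopt _ _),
            episodeRegret_eq]
          congr 1; ring
      _ = ∫⁻ q, ENNReal.ofReal (q.2.expectedReward (opt q.2)) ∂ρ := hswap
      _ ≤ ∫⁻ q, (ENNReal.ofReal (q.1.1.expectedReward (opt q.2)) +
          (∫⁻ e, ENNReal.ofReal (episodeBonus L q.1.2.history e) ∂(q.1.1.episodeLaw (opt q.2)) +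
          (τ * (inaccurateSet S A τ L k).indicator 1 (q.1.2.history, q.1.1) +
          τ * (inaccurateSet S A τ L k).indicator 1 (q.1.2.history, q.2)))) ∂ρ :=
          lintegral_mono fun q => ofReal_expectedReward_le L q.1.1 q.2 (opt q.2) q.1.2.history
      _ ≤ _ := by
          have hi1 : Measurable fun p : MDP S A × Record S A τ k =>
              (inaccurateSet S A τ L k).indicator (1 : History S A τ k × MDP S A → ENNReal) (p.2.history, p.1) :=
            hind.comp (hh.prodMk measurable_fst)
          have hi2 : Measurable fun q : (MDP S A × Record S A τ k) × MDP S A =>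
              (τ : ENNReal) * (inaccurateSet S A τ L k).indicator
                (1 : History S A τ k × MDP S A → ENNReal) (q.1.2.history, q.1.1) :=
            (hi1.comp measurable_fst).const_mul _
          rw [lintegral_add_left hJs, lintegral_add_left hbon, lintegral_add_left hi2,
            lintegral_const_mul' _ _ (ENNReal.natCast_ne_top τ),
            lintegral_const_mul' _ _ (ENNReal.natCast_ne_top τ)]
          refine add_le_add_right (add_le_add_right ?_ _) _
          rw [hRpost hind, hRfst hi1, ← two_mul, mul_assoc]
          gcongr
  rw [hR hreg, hR hbon] at hmain
  have hpol : ∀ {G : Policy S A τ → ENNReal}, Measurable G → ∀ h : History S A τ k,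
      ∫⁻ μ, G μ ∂(π.policyDist k h) = ∫⁻ M', G (opt M') ∂(Q h) := fun hG h => by
    rw [hπQ, Kernel.lintegral_map _ hm _ hG]
  simp_rw [hpol (measurable_of_countable _)]
  exact hmain

/-- The sum of the bonuses of the first `k` episodes. -/
def totalBonus (L : ℝ) : (k : ℕ) → History S A τ k → ℝ
  | 0, _ => 0
  | k + 1, h => totalBonus L k (fun l => h l.castSucc) +
      episodeBonus L (fun l : Fin k => h l.castSucc) (h (Fin.last k))

theorem totalBonus_nonneg (L : ℝ) : ∀ (k : ℕ) (h : History S A τ k), 0 ≤ totalBonus L k h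
  | 0, _ => le_rfl
  | k + 1, _ => add_nonneg (totalBonus_nonneg L k _) (episodeBonus_nonneg L _ _)

theorem measurable_totalBonus (L : ℝ) (k : ℕ) :
    Measurable (totalBonus L k : History S A τ k → ℝ) := by
  induction k with
  | zero => exact measurable_const
  | succ k ih =>
    have h1 : Measurable fun (h : History S A τ (k + 1)) (l : Fin k) => h l.castSucc :=
      measurable_pi_lambda _ fun l => measurable_pi_apply l.castSucc
    have h2 : Measurable fun h : History S A τ (k + 1) =>
        totalBonus L k (fun l => h l.castSucc) := ih.comp h1
    have h3 : Measurable fun h : History S A τ (k + 1) =>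
        ((fun l => h l.castSucc, h (Fin.last k)) : History S A τ k × Episode S A τ) :=
      h1.prodMk (measurable_pi_apply (Fin.last k))
    have h4 := (measurable_episodeBonus (S := S) (A := A) (τ := τ) L k).comp h3
    exact h2.add h4

theorem lintegral_regret_le (hm : Measurable opt) (hopt : ∀ M : MDP S A, M.IsOptimal (opt M))
    (hπ : IsPosteriorSampling opt f π) {L : ℝ} (hL : 0 ≤ L) :
    ∀ k : ℕ, ∫⁻ p, ENNReal.ofReal (∑ l, episodeRegret opt p.1 (p.2 l).1) ∂(interactionLaw f π k) ≤
      ∫⁻ p, ENNReal.ofReal (totalBonus L k p.2.history) ∂(interactionLaw f π k) +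
        ∑ l ∈ Finset.range k, 2 * τ * ENNReal.ofReal (failureBound S A τ L l)
  | 0 => by simp
  | k + 1 => by
    have ih := lintegral_regret_le hm hopt hπ hL k
    have hreg : ∀ k, Measurable fun p : MDP S A × Record S A τ k =>
        ENNReal.ofReal (∑ l, episodeRegret opt p.1 (p.2 l).1) := fun k =>
      (Finset.measurable_sum _ fun l _ => (measurable_episodeRegret hm).comp
        (measurable_fst.prodMk ((measurable_pi_apply l).comp measurable_snd).fst)).ennreal_ofReal
    have hbon : ∀ k, Measurable fun p : MDP S A × Record S A τ k =>
        ENNReal.ofReal (totalBonus L k p.2.history) := fun k =>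
      ((measurable_totalBonus L k).comp (measurable_history.comp measurable_snd)).ennreal_ofReal
    have hres : Measurable fun p : MDP S A × Record S A τ (k + 1) =>
        ((p.1, fun l => p.2 l.castSucc) : MDP S A × Record S A τ k) := by fun_prop
    have hlreg : Measurable fun p : MDP S A × Record S A τ (k + 1) =>
        ENNReal.ofReal (episodeRegret opt p.1 (p.2 (Fin.last k)).1) :=
      ((measurable_episodeRegret hm).comp (measurable_fst.prodMk
        ((measurable_pi_apply (Fin.last k)).comp measurable_snd).fst)).ennreal_ofReal
    have hlbon : Measurable fun p : MDP S A × Record S A τ (k + 1) =>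
        ENNReal.ofReal (episodeBonus L (Record.history fun l => p.2 l.castSucc : History S A τ k)
          (p.2 (Fin.last k)).2) :=
      ((measurable_episodeBonus L k).comp ((measurable_history.comp hres.snd).prodMk
        ((measurable_pi_apply (Fin.last k)).comp measurable_snd).snd)).ennreal_ofReal
    have e1 : ∫⁻ p, ENNReal.ofReal (∑ l, episodeRegret opt p.1 (p.2 l).1)
        ∂(interactionLaw f π (k + 1)) =
        ∫⁻ p, ENNReal.ofReal (∑ l, episodeRegret opt p.1 (p.2 l).1) ∂(interactionLaw f π k) +
        ∫⁻ p, ∫⁻ μ, ENNReal.ofReal (episodeRegret opt p.1 μ) ∂(π.policyDist k p.2.history)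
          ∂(interactionLaw f π k) := by
      rw [← lintegral_interactionLaw_init f π k (hreg k)]
      have e2 : ∫⁻ p, ENNReal.ofReal (episodeRegret opt p.1 (p.2 (Fin.last k)).1)
          ∂(interactionLaw f π (k + 1)) =
          ∫⁻ p, ∫⁻ μ, ENNReal.ofReal (episodeRegret opt p.1 μ) ∂(π.policyDist k p.2.history)
          ∂(interactionLaw f π k) := by
        rw [lintegral_interactionLaw_succ f π k hlreg]
        have h1 : ∀ (M : MDP S A) (μ : Policy S A τ), (M.episodeLaw μ) Set.univ = 1 := fun M μ =>
          (isMarkovKernel_episodeKernel.isProbabilityMeasure (M, μ)).measure_univ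
        simp only [extend_last, lintegral_const, h1, mul_one]
      rw [← e2, ← lintegral_add_right _ hlreg]
      refine lintegral_congr fun p => ?_
      rw [Fin.sum_univ_castSucc, ENNReal.ofReal_add
        (Finset.sum_nonneg fun _ _ => episodeRegret_nonneg hopt _ _)
        (episodeRegret_nonneg hopt _ _)]
    have e3 : ∫⁻ p, ENNReal.ofReal (totalBonus L (k + 1) p.2.history)
        ∂(interactionLaw f π (k + 1)) =
        ∫⁻ p, ENNReal.ofReal (totalBonus L k p.2.history) ∂(interactionLaw f π k) +
        ∫⁻ p, ∫⁻ μ, ∫⁻ e, ENNReal.ofReal (episodeBonus L p.2.history e) ∂(p.1.episodeLaw μ)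
          ∂(π.policyDist k p.2.history) ∂(interactionLaw f π k) := by
      rw [← lintegral_interactionLaw_init f π k (hbon k)]
      have e4 : ∫⁻ p, ENNReal.ofReal (episodeBonus L
          (Record.history fun l => p.2 l.castSucc : History S A τ k) (p.2 (Fin.last k)).2)
          ∂(interactionLaw f π (k + 1)) =
          ∫⁻ p, ∫⁻ μ, ∫⁻ e, ENNReal.ofReal (episodeBonus L p.2.history e) ∂(p.1.episodeLaw μ)
            ∂(π.policyDist k p.2.history) ∂(interactionLaw f π k) := by
        rw [lintegral_interactionLaw_succ f π k hlbon]
        simp only [extend_last, init_extend]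
      rw [← e4, ← lintegral_add_right _ hlbon]
      refine lintegral_congr fun p => ?_
      rw [← ENNReal.ofReal_add (totalBonus_nonneg _ _ _) (episodeBonus_nonneg _ _ _)]
      rfl
    rw [e1, e3, Finset.sum_range_succ]
    refine (add_le_add ih (lintegral_episodeRegret_le hm hopt hπ k hL)).trans (le_of_eq ?_)
    ring

end Regret

section Pigeonhole

/-- A potential whose increments dominate the confidence widths that are met. -/
def widthPotential (L : ℝ) (τ N : ℕ) : ℝ :=
  2 * (min N (2 * τ) : ℕ) + 6 * √(2 * L) * √N

theorem mul_confWidth_le {L : ℝ} (hL : 0 ≤ L) {τ n : ℕ} (hn : n ≤ τ) (N : ℕ) :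
    n * confWidth L N ≤ widthPotential L τ (N + n) - widthPotential L τ N := by
  unfold widthPotential
  have hs : √(N : ℝ) ≤ √((N + n : ℕ) : ℝ) := Real.sqrt_le_sqrt (by push_cast; linarith [n.cast_nonneg (α := ℝ)])
  have h2L : 0 ≤ √(2 * L) := Real.sqrt_nonneg _
  rcases lt_or_ge N τ with hN | hN
  · rw [min_eq_left (by omega : N + n ≤ 2 * τ), min_eq_left (by omega : N ≤ 2 * τ)]
    have h1 := mul_le_mul_of_nonneg_left (confWidth_le_two L N) (n.cast_nonneg (α := ℝ))
    have h2 := mul_le_mul_of_nonneg_left hs (by positivity : 0 ≤ 6 * √(2 * L))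
    push_cast at h2 ⊢
    linarith
  · have hm : ((min N (2 * τ) : ℕ) : ℝ) ≤ (min (N + n) (2 * τ) : ℕ) := by
      exact_mod_cast min_le_min_right _ (Nat.le_add_right _ _)
    rcases Nat.eq_zero_or_pos N with h0 | h0
    · have : n = 0 := by omega
      subst this; simp
    have hN0 : (0 : ℝ) < N := by exact_mod_cast h0
    have hw : confWidth L N ≤ 2 * (√(2 * L) / √N) := by
      unfold confWidth
      rw [if_neg h0.ne', ← Real.sqrt_div (by positivity)]
      exact min_le_right _ _
    set a := √(N : ℝ)
    set b := √((N + n : ℕ) : ℝ)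
    have ha : 0 < a := Real.sqrt_pos.2 hN0
    have ha2 : a ^ 2 = N := Real.sq_sqrt hN0.le
    have hb2 : b ^ 2 = N + n := by
      rw [Real.sq_sqrt (by positivity)]; push_cast; ring
    have hnN : (n : ℝ) ≤ N := by exact_mod_cast hn.trans hN
    have hb : b ≤ 2 * a := by
      refine abs_le_of_sq_le_sq' ?_ (by positivity) |>.2
      nlinarith
    have hdiv : (n : ℝ) / a ≤ 3 * (b - a) := by
      rw [div_le_iff₀ ha]
      have : (n : ℝ) = (b - a) * (b + a) := by nlinarith
      rw [this, mul_right_comm, mul_comm _ (b - a)]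
      exact mul_le_mul_of_nonneg_left (by linarith) (by linarith)
    have h1 : n * confWidth L N ≤ 6 * √(2 * L) * (b - a) := by
      calc n * confWidth L N ≤ n * (2 * (√(2 * L) / a)) :=
            mul_le_mul_of_nonneg_left hw (Nat.cast_nonneg _)
        _ = 2 * √(2 * L) * (n / a) := by ring
        _ ≤ 2 * √(2 * L) * (3 * (b - a)) := mul_le_mul_of_nonneg_left hdiv (by positivity)
        _ = _ := by ring
    linarith

theorem sum_widthPotential_le {ι : Type*} [Fintype ι] (L : ℝ) (τ : ℕ) (N : ι → ℕ) {X : ℝ}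
    (hN : ((∑ c, N c : ℕ) : ℝ) ≤ X) :
    ∑ c, widthPotential L τ (N c) ≤
      4 * τ * Fintype.card ι + 6 * √(2 * L) * √(Fintype.card ι * X) := by
  unfold widthPotential
  rw [Finset.sum_add_distrib, ← Finset.mul_sum _ _ (6 * √(2 * L))]
  refine add_le_add ?_ (mul_le_mul_of_nonneg_left ?_ (by positivity))
  · have : ∀ c, (2 : ℝ) * ((min (N c) (2 * τ) : ℕ) : ℝ) ≤ 4 * τ := fun c => by
      have : ((min (N c) (2 * τ) : ℕ) : ℝ) ≤ 2 * τ := by exact_mod_cast min_le_right _ _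
      linarith
    refine (Finset.sum_le_sum fun c _ => this c).trans (le_of_eq ?_)
    rw [Finset.sum_const, Finset.card_univ, nsmul_eq_mul, mul_comm]
  · refine Real.le_sqrt_of_sq_le ?_
    refine (sq_sum_le_card_mul_sum_sq).trans ?_
    rw [Finset.card_univ]
    refine mul_le_mul_of_nonneg_left (le_trans (le_of_eq ?_) hN) (Nat.cast_nonneg _)
    push_cast
    exact Finset.sum_congr rfl fun c _ => Real.sq_sqrt (Nat.cast_nonneg _)

variable {S A : Type*} [Fintype S] [DecidableEq S] [Fintype A] [DecidableEq A] {τ : ℕ}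

theorem sum_transCount (e : Episode S A τ) : ∑ c, transCount c e = τ := by
  unfold transCount
  rw [Finset.sum_comm]
  simp

theorem sum_rewardCount (e : Episode S A τ) : ∑ c, rewardCount c e = τ := by
  unfold rewardCount
  rw [Finset.sum_comm]
  simp

theorem totalBonus_le_potential {L : ℝ} (hL : 0 ≤ L) : ∀ (k : ℕ) (h : History S A τ k),
    totalBonus L k h ≤ τ * ∑ c, widthPotential L τ (∑ l, transCount c (h l)) +
      ∑ c, widthPotential L τ (∑ l, rewardCount c (h l))
  | 0, h => by simp [totalBonus, widthPotential]
  | k + 1, h => by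
    have ih := totalBonus_le_potential hL k fun l => h l.castSucc
    simp only [totalBonus, episodeBonus, Fin.sum_univ_castSucc]
    have h1 := Finset.sum_le_sum fun (c : Option (S × A)) (_ : c ∈ Finset.univ) =>
      mul_confWidth_le hL (transCount_le c (h (Fin.last k)))
        (∑ l : Fin k, transCount c (h l.castSucc))
    have h2 := Finset.sum_le_sum fun (c : S × A) (_ : c ∈ Finset.univ) =>
      mul_confWidth_le hL (rewardCount_le c (h (Fin.last k)))
        (∑ l : Fin k, rewardCount c (h l.castSucc))
    rw [Finset.sum_sub_distrib] at h1 h2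
    have h3 := mul_le_mul_of_nonneg_left h1 (Nat.cast_nonneg (α := ℝ) τ)
    rw [mul_sub] at h3
    linarith

theorem totalBonus_le [NeZero τ] [Nonempty S] [Nonempty A] {L : ℝ} (hL : 0 ≤ L) (k : ℕ)
    (h : History S A τ k) :
    totalBonus L k h ≤ 12 * τ ^ 2 * (Fintype.card S * Fintype.card A) +
      26 * τ * √(L * (Fintype.card S * Fintype.card A) * (k * τ)) := by
  refine (totalBonus_le_potential hL k h).trans ?_
  have h1 := sum_widthPotential_le L τ (fun c => ∑ l, transCount c (h l)) (X := k * τ) (by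
    rw [Finset.sum_comm]
    simp only [sum_transCount, Finset.sum_const, Finset.card_univ, Fintype.card_fin, smul_eq_mul]
    push_cast
    rfl)
  have h2 := sum_widthPotential_le L τ (fun c => ∑ l, rewardCount c (h l)) (X := k * τ) (by
    rw [Finset.sum_comm]
    simp only [sum_rewardCount, Finset.sum_const, Finset.card_univ, Fintype.card_fin, smul_eq_mul]
    push_cast
    rfl)
  rw [Fintype.card_option, Fintype.card_prod] at h1
  rw [Fintype.card_prod] at h2
  push_cast at h1 h2
  have hτ : (1 : ℝ) ≤ τ := by exact_mod_cast NeZero.one_le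
  have hS : (1 : ℝ) ≤ Fintype.card S := by exact_mod_cast Fintype.card_pos
  have hA : (1 : ℝ) ≤ Fintype.card A := by exact_mod_cast Fintype.card_pos
  have hq : (1 : ℝ) ≤ Fintype.card S * Fintype.card A := one_le_mul_of_one_le_of_one_le hS hA
  have hX : (0 : ℝ) ≤ k * τ := by positivity
  generalize (Fintype.card S * Fintype.card A : ℝ) = q at *
  generalize (k * τ : ℝ) = X at *
  generalize (τ : ℝ) = t at *
  set W := √(L * q * X)
  have hW : 0 ≤ W := Real.sqrt_nonneg _
  have e2 : √(2 * L) * √(q * X) = √2 * W := by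
    rw [← Real.sqrt_mul (by positivity), ← Real.sqrt_mul (by positivity)]
    congr 1; ring
  have e1 : √(2 * L) * √((q + 1) * X) ≤ 2 * W := by
    rw [← Real.sqrt_mul (by positivity)]
    refine Real.sqrt_le_iff.2 ⟨by positivity, ?_⟩
    rw [mul_pow, Real.sq_sqrt (by positivity)]
    have : 0 ≤ L * X := by positivity
    nlinarith
  have hs2 : √2 ≤ (3 / 2 : ℝ) := Real.sqrt_le_iff.2 ⟨by norm_num, by norm_num⟩
  have e3 : √2 * W ≤ 3 / 2 * W := mul_le_mul_of_nonneg_right hs2 hW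
  have f1 : t * ∑ c : Option (S × A), widthPotential L τ (∑ l, transCount c (h l)) ≤
      t * (4 * t * (q + 1) + 12 * W) :=
    mul_le_mul_of_nonneg_left (by linarith) (by linarith)
  have g1 : t * (4 * t * (q + 1)) ≤ 8 * t ^ 2 * q := by
    have : t ^ 2 * 1 ≤ t ^ 2 * q := mul_le_mul_of_nonneg_left hq (by positivity)
    nlinarith
  have g2 : 4 * t * q ≤ 4 * t ^ 2 * q := by
    have : t * q * 1 ≤ t * q * t := mul_le_mul_of_nonneg_left hτ (by positivity)
    nlinarith
  have g3 : W ≤ t * W := le_mul_of_one_le_left hW hτ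
  nlinarith

end Pigeonhole

section Main

theorem regret_bound_arith {S A T τ X L E ℓ : ℝ} (hS : 1 ≤ S) (hA : 1 ≤ A) (hT : 1 ≤ T)
    (hτ : 1 ≤ τ) (hℓ : 0.69 ≤ ℓ) (hX : 0 ≤ X) (hXT : X ≤ 2 * T)
    (hLℓ : L ≤ 7 * S * ℓ) (hEX : E ≤ X)
    (hE : E ≤ 12 * τ ^ 2 * (S * A) + 26 * τ * √(L * (S * A) * X) + 2) :
    E ≤ 120 * (τ * S * √(A * T * ℓ)) := by
  have hAT : 1 ≤ A * T := one_le_mul_of_one_le_of_one_le hA hT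
  set W := √(A * T * ℓ)
  have hW2 : W ^ 2 = A * T * ℓ := Real.sq_sqrt (by positivity)
  have hW : 0.8 ≤ W := Real.le_sqrt_of_sq_le (by nlinarith)
  have hτS : 1 ≤ τ * S := one_le_mul_of_one_le_of_one_le hτ hS
  have h2 : 2 ≤ 3 * (τ * S * W) := by nlinarith
  have hroot : √(L * (S * A) * X) ≤ 4 * (S * W) := by
    refine Real.sqrt_le_iff.2 ⟨by positivity, ?_⟩
    calc L * (S * A) * X ≤ (7 * S * ℓ) * (S * A) * (2 * T) := by gcongr
      _ = 14 * (S ^ 2 * (A * T * ℓ)) := by ring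
      _ ≤ 16 * (S ^ 2 * (A * T * ℓ)) := by gcongr; norm_num
      _ = _ := by rw [← hW2]; ring
  have hroot' : 26 * τ * √(L * (S * A) * X) ≤ 104 * (τ * S * W) := by
    calc _ ≤ 26 * τ * (4 * (S * W)) := by gcongr
      _ = _ := by ring
  have hmin : min X (12 * τ ^ 2 * (S * A)) ≤ 6 * (τ * S * W) := by
    set m := min X (12 * τ ^ 2 * (S * A))
    have hm0 : 0 ≤ m := le_min hX (by positivity)
    refine abs_le_of_sq_le_sq' ?_ (by positivity) |>.2
    calc m ^ 2 = m * m := sq m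
      _ ≤ (2 * T) * (12 * τ ^ 2 * (S * A)) :=
          mul_le_mul ((min_le_left _ _).trans hXT) (min_le_right _ _) hm0 (by positivity)
      _ = (S * τ ^ 2 * (A * T)) * 24 := by ring
      _ ≤ (S * τ ^ 2 * (A * T)) * (36 * (S * ℓ)) := by gcongr; nlinarith
      _ = 36 * τ ^ 2 * S ^ 2 * W ^ 2 := by rw [hW2]; ring
      _ = _ := by ring
  have hpos : 0 ≤ τ * S * W := by positivity
  rcases le_total X (12 * τ ^ 2 * (S * A)) with h | h
  · rw [min_eq_left h] at hmin; linarith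
  · rw [min_eq_right h] at hmin; linarith

variable {S A : Type*} [Fintype S] [DecidableEq S] [Fintype A]
  [MeasurableSpace S] [DiscreteMeasurableSpace S]
  [MeasurableSpace A] [DiscreteMeasurableSpace A] {τ : ℕ} [NeZero τ]
  {opt : MDP S A → Policy S A τ} {f : Measure (MDP S A)} [IsProbabilityMeasure f]
  {π : Algorithm S A τ}

theorem sum_failureBound_le [Nonempty S] [Nonempty A] {m : ℕ} (hm : 0 < m) {L : ℝ}
    (hL : Real.exp L = 4 * (Fintype.card S * Fintype.card A) * 2 ^ Fintype.card S *
      (m * τ) ^ 2) :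
    ∑ l ∈ Finset.range m, 2 * (τ : ENNReal) * ENNReal.ofReal (failureBound S A τ L l) ≤
      ENNReal.ofReal 2 := by
  have hτ : (1 : ℝ) ≤ τ := by exact_mod_cast NeZero.one_le
  have hm1 : (1 : ℝ) ≤ m := by exact_mod_cast hm
  have hS : (1 : ℝ) ≤ Fintype.card S := by exact_mod_cast Fintype.card_pos
  have hA : (1 : ℝ) ≤ Fintype.card A := by exact_mod_cast Fintype.card_pos
  have hq : (1 : ℝ) ≤ Fintype.card S * Fintype.card A := one_le_mul_of_one_le_of_one_le hS hA
  have h2 : (1 : ℝ) ≤ 2 ^ Fintype.card S / 2 := by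
    rw [le_div_iff₀ (by norm_num), one_mul]
    exact le_self_pow₀ (by norm_num) Fintype.card_ne_zero
  have hone : ∀ l ∈ Finset.range m, 2 * (τ : ENNReal) * ENNReal.ofReal (failureBound S A τ L l) ≤
      ENNReal.ofReal (2 / m) := by
    intro l hl
    have hlm : (l : ℝ) ≤ m := by exact_mod_cast (Finset.mem_range.1 hl).le
    rw [show (2 * (τ : ENNReal)) = ENNReal.ofReal (2 * τ) by
      rw [ENNReal.ofReal_mul (by norm_num)]; simp, ← ENNReal.ofReal_mul (by positivity)]
    refine ENNReal.ofReal_le_ofReal ?_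
    unfold failureBound
    rw [Fintype.card_option, Fintype.card_prod, Real.exp_neg, hL]
    push_cast
    generalize (Fintype.card S * Fintype.card A : ℝ) = q at *
    generalize (2 : ℝ) ^ Fintype.card S = P at *
    have hcoef : (q + 1) * P + q * 2 ≤ 4 * q * P := by nlinarith
    have hP : 0 < P := by linarith
    calc _ ≤ 2 * (τ : ℝ) * ((4 * q * P) * (m * τ * (4 * q * P * (m * τ) ^ 2)⁻¹)) := by gcongr
      _ = _ := by field_simp
  refine (Finset.sum_le_sum hone).trans (le_of_eq ?_)
  rw [Finset.sum_const, Finset.card_range, nsmul_eq_mul, ← ENNReal.ofReal_natCast,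
    ← ENNReal.ofReal_mul (by positivity)]
  congr 1
  field_simp

theorem measurable_sum_episodeRegret (hm : Measurable opt) (k : ℕ) :
    Measurable fun p : MDP S A × Record S A τ k => ∑ l, episodeRegret opt p.1 (p.2 l).1 :=
  Finset.measurable_sum _ fun l _ => (measurable_episodeRegret hm).comp
    (measurable_fst.prodMk ((measurable_pi_apply l).comp measurable_snd).fst)

theorem sum_episodeRegret_le (k : ℕ) (p : MDP S A × Record S A τ k) :
    ∑ l, episodeRegret opt p.1 (p.2 l).1 ≤ k * τ := by
  refine (Finset.sum_le_sum fun l _ => episodeRegret_le opt _ _).trans ?_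
  simp

/-- An explicit bound on the regret of the first `m` episodes of posterior sampling. -/
theorem integral_sum_episodeRegret_le [Nonempty S] [Nonempty A] (hm : Measurable opt)
    (hopt : ∀ M : MDP S A, M.IsOptimal (opt M)) (hπ : IsPosteriorSampling opt f π) {m : ℕ}
    (hm0 : 0 < m) {L : ℝ} (hL0 : 0 ≤ L)
    (hL : Real.exp L = 4 * (Fintype.card S * Fintype.card A) * 2 ^ Fintype.card S *
      (m * τ) ^ 2) :
    ∫ p, ∑ l, episodeRegret opt p.1 (p.2 l).1 ∂(interactionLaw f π m) ≤
      12 * τ ^ 2 * (Fintype.card S * Fintype.card A) +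
      26 * τ * √(L * (Fintype.card S * Fintype.card A) * (m * τ)) + 2 := by
  classical
  have := isProbabilityMeasure_interactionLaw f π m
  rw [integral_eq_lintegral_of_nonneg_ae
    (ae_of_all _ fun p => Finset.sum_nonneg fun l _ => episodeRegret_nonneg hopt _ _)
    (measurable_sum_episodeRegret hm m).aestronglyMeasurable]
  refine ENNReal.toReal_le_of_le_ofReal (by positivity) ?_
  refine (lintegral_regret_le hm hopt hπ hL0 m).trans ?_
  rw [ENNReal.ofReal_add (by positivity) (by norm_num)]
  refine add_le_add ?_ (sum_failureBound_le hm0 hL)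
  refine (lintegral_mono fun p : MDP S A × Record S A τ m =>
    ENNReal.ofReal_le_ofReal (totalBonus_le hL0 m p.2.history)).trans ?_
  simp

end Main

end PSRL

end

theorem theorem1 :
    ∃ C : ℝ, ∀ (S A : Type _) [Fintype S] [DecidableEq S] [Fintype A]
      [MeasurableSpace S] [DiscreteMeasurableSpace S]
      [MeasurableSpace A] [DiscreteMeasurableSpace A]
      (τ : ℕ) [NeZero τ]
      (opt : PSRL.MDP S A → PSRL.Policy S A τ)
      (_ : Measurable opt) (_ : ∀ M : PSRL.MDP S A, M.IsOptimal (opt M))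
      (f : MeasureTheory.Measure (PSRL.MDP S A)) [MeasureTheory.IsProbabilityMeasure f]
      (π : PSRL.Algorithm S A τ) (_ : PSRL.IsPosteriorSampling opt f π)
      (T : ℕ),
      MeasureTheory.Integrable (PSRL.regret opt T)
          (PSRL.interactionLaw f π (PSRL.numEpisodes τ T)) ∧
        ∫ p, PSRL.regret opt T p ∂(PSRL.interactionLaw f π (PSRL.numEpisodes τ T)) ≤
          C * (τ * Fintype.card S * Real.sqrt (Fintype.card A * T *
            Real.log (Fintype.card S * Fintype.card A * T))) := by
  refine ⟨120, ?_⟩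
  intro S A _ _ _ _ _ _ _ τ _ opt hm hopt f _ π hπ T
  obtain ⟨M₀⟩ : Nonempty (PSRL.MDP S A) := nonempty_of_isProbabilityMeasure f
  have : Nonempty S := PSRL.nonempty_of_MDP M₀
  have : Nonempty A := ⟨opt M₀ 0 (Classical.arbitrary S)⟩
  have := PSRL.isProbabilityMeasure_interactionLaw f π (PSRL.numEpisodes τ T)
  have hnn : ∀ p, 0 ≤ PSRL.regret opt T p := fun p =>
    Finset.sum_nonneg fun l _ => PSRL.episodeRegret_nonneg hopt _ _
  have hle : ∀ p, PSRL.regret opt T p ≤ PSRL.numEpisodes τ T * τ := fun p =>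
    PSRL.sum_episodeRegret_le _ p
  have hint : Integrable (PSRL.regret opt T)
      (PSRL.interactionLaw f π (PSRL.numEpisodes τ T)) := by
    refine Integrable.of_bound
      (PSRL.measurable_sum_episodeRegret hm _).aestronglyMeasurable
      (PSRL.numEpisodes τ T * τ) (ae_of_all _ fun p => ?_)
    rw [Real.norm_of_nonneg (hnn p)]
    exact hle p
  refine ⟨hint, ?_⟩
  have hEX : ∫ p, PSRL.regret opt T p ∂(PSRL.interactionLaw f π (PSRL.numEpisodes τ T)) ≤
      PSRL.numEpisodes τ T * τ := by
    refine (integral_mono hint (integrable_const _) hle).trans ?_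
    simp
  have hτ : (1 : ℝ) ≤ τ := by exact_mod_cast NeZero.one_le
  have hS : (1 : ℝ) ≤ Fintype.card S := by exact_mod_cast Fintype.card_pos
  have hA : (1 : ℝ) ≤ Fintype.card A := by exact_mod_cast Fintype.card_pos
  have hq : (1 : ℝ) ≤ Fintype.card S * Fintype.card A := one_le_mul_of_one_le_of_one_le hS hA
  rcases Nat.eq_zero_or_pos T with hT0 | hT0
  · refine hEX.trans ?_
    have : PSRL.numEpisodes τ T = 0 := by simp [PSRL.numEpisodes, hT0]
    rw [this]
    simp only [Nat.cast_zero, zero_mul]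
    positivity
  have hT : (1 : ℝ) ≤ T := by exact_mod_cast hT0
  by_cases hone : Fintype.card S * Fintype.card A * T = 1
  · have hA1 : Fintype.card A = 1 := Nat.eq_one_of_mul_eq_one_left (Nat.eq_one_of_mul_eq_one_right hone)
    have : Subsingleton A := Fintype.card_le_one_iff_subsingleton.1 hA1.le
    have h0 : ∀ p, PSRL.regret opt T p = 0 := fun p => by
      refine Finset.sum_eq_zero fun l _ => ?_
      rw [PSRL.episodeRegret_eq, Subsingleton.elim (opt p.1) (p.2 l).1, sub_self]
    simp only [h0, integral_zero]
    positivity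
  have htwo : (2 : ℝ) ≤ Fintype.card S * Fintype.card A * T := by
    have : 0 < Fintype.card S * Fintype.card A * T := by positivity
    have : 2 ≤ Fintype.card S * Fintype.card A * T := by omega
    exact_mod_cast this
  have hlog2 : Real.log 2 ≤ Real.log (Fintype.card S * Fintype.card A * T) :=
    Real.log_le_log (by norm_num) htwo
  have hℓ : 0.69 ≤ Real.log (Fintype.card S * Fintype.card A * T) := by
    linarith [Real.log_two_gt_d9]
  have hm0 : 0 < PSRL.numEpisodes τ T := Nat.ceil_pos.2 (by positivity)
  have hX1 : (1 : ℝ) ≤ PSRL.numEpisodes τ T * τ :=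
    one_le_mul_of_one_le_of_one_le (by exact_mod_cast hm0) hτ
  have hXτ : (PSRL.numEpisodes τ T : ℝ) * τ ≤ T + τ := by
    have h1 : (PSRL.numEpisodes τ T : ℝ) < (T : ℝ) / τ + 1 := Nat.ceil_lt_add_one (by positivity)
    have h2 := mul_le_mul_of_nonneg_right h1.le (by positivity : (0 : ℝ) ≤ τ)
    rwa [add_mul, div_mul_cancel₀ _ (by positivity), one_mul] at h2
  rcases lt_or_ge T τ with hTτ | hTτ
  · have hm1 : PSRL.numEpisodes τ T ≤ 1 := by
      refine Nat.ceil_le.2 ?_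
      rw [Nat.cast_one, div_le_one (by positivity)]
      exact_mod_cast hTτ.le
    have hm1' : (PSRL.numEpisodes τ T : ℝ) ≤ 1 := by exact_mod_cast hm1
    have hW : 0.8 ≤ √(Fintype.card A * T * Real.log (Fintype.card S * Fintype.card A * T)) := by
      refine Real.le_sqrt_of_sq_le ?_
      have : (1 : ℝ) ≤ Fintype.card A * T := one_le_mul_of_one_le_of_one_le hA hT
      nlinarith
    have h1 : (τ : ℝ) ≤ τ * Fintype.card S := le_mul_of_one_le_right (by positivity) hS
    refine hEX.trans ?_
    nlinarith
  · have hTτ' : (τ : ℝ) ≤ T := by exact_mod_cast hTτ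
    have hXT : (PSRL.numEpisodes τ T : ℝ) * τ ≤ 2 * T := by linarith
    have hK1 : (1 : ℝ) ≤ 4 * (Fintype.card S * Fintype.card A) * 2 ^ Fintype.card S *
        (PSRL.numEpisodes τ T * τ) ^ 2 := by
      refine one_le_mul_of_one_le_of_one_le (one_le_mul_of_one_le_of_one_le (by linarith) ?_) ?_
      · exact one_le_pow₀ (by norm_num)
      · exact one_le_pow₀ hX1
    have hL0 := Real.log_nonneg hK1
    have hLexp := Real.exp_log (lt_of_lt_of_le one_pos hK1)
    have hE := PSRL.integral_sum_episodeRegret_le hm hopt hπ hm0 hL0 hLexp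
    refine PSRL.regret_bound_arith hS hA hT hτ hℓ (by positivity) hXT ?_ hEX hE
    have hle4 : Real.log (4 * (Fintype.card S * Fintype.card A) * 2 ^ Fintype.card S *
        (PSRL.numEpisodes τ T * τ) ^ 2) ≤ Real.log (2 ^ (4 + Fintype.card S) *
          (Fintype.card S * Fintype.card A * T) ^ 2) := by
      refine Real.log_le_log (by positivity) ?_
      calc _ ≤ 4 * ((Fintype.card S * Fintype.card A : ℝ) ^ 2) * 2 ^ Fintype.card S *
            (2 * T) ^ 2 := by
            gcongr
            exact le_self_pow₀ hq two_ne_zero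
        _ = _ := by rw [pow_add]; ring
    refine hle4.trans ?_
    rw [Real.log_mul (by positivity) (by positivity), Real.log_pow, Real.log_pow]
    push_cast
    nlinarith
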